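/- Let $X\in\mathbb R^p$ and $Y\in\mathbb R^q$ be jointly distributed random vectors with $\mathbb E\|X\|<\infty$ and $\mathbb E\|Y\|<\infty$, and let $\phi_{X,Y}(s,t)=\mathbb E\,e^{i\langle s,X\rangle+i\langle t,Y\rangle}$, $\phi_X(s)=\phi_{X,Y}(s,0)$, $\phi_Y(t)=\phi_{X,Y}(0,t)$. With $c_p=\pi^{(p+1)/2}/\Gamma((p+1)/2)$, the squared distance covariance is $$\mathcal V^2(X,Y)=\frac1{c_pc_q}\int_{\mathbb R^p}\int_{\mathbb R^q}\frac{|\phi_{X,Y}(s,t)-\phi_X(s)\phi_Y(t)|^2}{\|s\|^{p+1}\|t\|^{q+1}}\,dt\,ds .$$ Define the symmetric kernel $$h\big((x_1,y_1),\ldots,(x_4,y_4)\big)=\frac1{24}\sum\big(\|x_i-x_j\|\|y_i-y_j\|-2\|x_i-x_j\|\|y_i-y_k\|+\|x_i-x_j\|\|y_k-y_l\|\big),$$ where the sum is over all distinct $i,j,k,l\in\{1,2,3,4\}$. Let $(X_1,Y_1),(X_2,Y_2),\ldots$ be i.i.d. copies of $(X,Y)$, let $$h_1(x,y)=\mathbb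 E\,h\big((x,y),(X_2,Y_2),(X_3,Y_3),(X_4,Y_4)\big),$$ and let $$\widehat\Omega=\binom n4^{-1}\sum_{1\le i<j<k<l\le n}h\big((X_i,Y_i),(X_j,Y_j),(X_k,Y_k),(X_l,Y_l)\big).$$ Suppose that $\mathbb E\,h\big((X_1,Y_1),\ldots,(X_4,Y_4)\big)^2<\infty$ and $0<\mathrm{Var}(h_1(X,Y))<\infty$. Then $\mathcal V^2(X,Y)<\infty$, and, as $n\to\infty$, $\sqrt n\,\big(\widehat\Omega-\mathcal V^2(X,Y)\big)$ converges in distribution to $Z$, where $Z\sim\mathcal N\big(0,16\,\mathrm{Var}(h_1(X,Y))\big)$. -/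

import Mathlib

open MeasureTheory ProbabilityTheory Filter Topology
open scoped ENNReal

noncomputable section

namespace DistCov

/-- The normalizing constant `c_p = π^((p+1)/2) / Γ((p+1)/2)`. -/
def normConst (p : ℕ) : ℝ :=
  Real.pi ^ (((p : ℝ) + 1) / 2) / Real.Gamma (((p : ℝ) + 1) / 2)

/-- The joint characteristic function
`φ_{X,Y}(s,t) = E exp(i⟨s,X⟩ + i⟨t,Y⟩)` of two random vectors. -/
def jointCharFun {Ω : Type*} [MeasurableSpace Ω] {p q : ℕ} (P : Measure Ω)
    (X : Ω → EuclideanSpace ℝ (Fin p)) (Y : Ω → EuclideanSpace ℝ (Fin q))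
    (s : EuclideanSpace ℝ (Fin p)) (t : EuclideanSpace ℝ (Fin q)) : ℂ :=
  ∫ ω, Complex.exp (Complex.I * ((inner ℝ s (X ω) : ℝ) : ℂ)
    + Complex.I * ((inner ℝ t (Y ω) : ℝ) : ℂ)) ∂P

/-- The squared distance covariance `𝒱²(X,Y)`, as a number in `[0,∞]`:
`(c_p c_q)⁻¹ ∫∫ |φ_{X,Y}(s,t) - φ_X(s) φ_Y(t)|² / (‖s‖^(p+1) ‖t‖^(q+1)) ds dt`. -/
def dcovSq {Ω : Type*} [MeasurableSpace Ω] {p q : ℕ} (P : Measure Ω)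
    (X : Ω → EuclideanSpace ℝ (Fin p)) (Y : Ω → EuclideanSpace ℝ (Fin q)) : ℝ≥0∞ :=
  ENNReal.ofReal (1 / (normConst p * normConst q)) *
    ∫⁻ s : EuclideanSpace ℝ (Fin p), ∫⁻ t : EuclideanSpace ℝ (Fin q),
      ENNReal.ofReal
        (‖jointCharFun P X Y s t - jointCharFun P X Y s 0 * jointCharFun P X Y 0 t‖ ^ 2
          / (‖s‖ ^ (p + 1) * ‖t‖ ^ (q + 1)))

/-- The symmetric kernel `h` of order 4. The sum over distinct `i, j, k, l` is a sum over the
permutations `σ` of four indices, with `(i, j, k, l) = (σ 0, σ 1, σ 2, σ 3)`. -/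
def kernel {p q : ℕ} (z : Fin 4 → EuclideanSpace ℝ (Fin p) × EuclideanSpace ℝ (Fin q)) : ℝ :=
  (1 / 24) * ∑ σ : Equiv.Perm (Fin 4),
    (‖(z (σ 0)).1 - (z (σ 1)).1‖ * ‖(z (σ 0)).2 - (z (σ 1)).2‖
      - 2 * (‖(z (σ 0)).1 - (z (σ 1)).1‖ * ‖(z (σ 0)).2 - (z (σ 2)).2‖)
      + ‖(z (σ 0)).1 - (z (σ 1)).1‖ * ‖(z (σ 2)).2 - (z (σ 3)).2‖)

/-- The first projection `h₁(z) = E h(z, Z₂, Z₃, Z₄)`, where `Z₂, Z₃, Z₄` are independent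
with law `μ`. -/
def kernelProj {p q : ℕ} (μ : Measure (EuclideanSpace ℝ (Fin p) × EuclideanSpace ℝ (Fin q)))
    (z : EuclideanSpace ℝ (Fin p) × EuclideanSpace ℝ (Fin q)) : ℝ :=
  ∫ w : Fin 3 → EuclideanSpace ℝ (Fin p) × EuclideanSpace ℝ (Fin q),
    kernel (Fin.cons z w : Fin 4 → EuclideanSpace ℝ (Fin p) × EuclideanSpace ℝ (Fin q))
    ∂(Measure.pi fun _ => μ)

open Classical in
/-- The U-statistic `Ω̂` of a sample of size `n`: the average of `h` over all index quadruples
`i < j < k < l`, given as strictly increasing maps `Fin 4 → Fin n`. -/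
def uStat {p q : ℕ} (n : ℕ)
    (z : Fin n → EuclideanSpace ℝ (Fin p) × EuclideanSpace ℝ (Fin q)) : ℝ :=
  ((n.choose 4 : ℕ) : ℝ)⁻¹ *
    ∑ τ ∈ Finset.univ.filter (fun τ : Fin 4 → Fin n => StrictMono τ), kernel (fun a => z (τ a))

end DistCov

end

/-!
The distance on a Euclidean space is half of a squared `L²` distance: up to a constant, `‖x - y‖` is
the integral of `|e^{i⟪t, x⟫} - e^{i⟪t, y⟫}|²` against `‖t‖ ^ (-(d + 1)) dt`, as one sees by writing
the weight as a Laplace transform and computing Gaussian integrals over `t`. Polarisation turns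
inner products of differences of plane waves into mixed second differences of the distance.
Therefore, by Fubini, `𝒱²(X, Y)` is, up to a factor, the expectation of a product of two mixed
differences, one in `X` and one in `Y`. Averaged over the permutations of four points this product
is a multiple of the kernel `h`, hence `𝒱²(X, Y) = E h < ∞`.

The limit law is Hoeffding's theorem: a U-statistic of order `k` equals its mean, plus `k / n` times
a sum of centred first projections, plus the U-statistic of a degenerate kernel. For a degenerate
kernel, index tuples sharing at most one index give orthogonal terms, so its second moment is
`O(n⁻²)`. Thus only the sum of i.i.d. first projections survives multiplication by `√n`, and it is
governed by the central limit theorem.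
-/

namespace DistCov

open Module (finrank)
open scoped ComplexConjugate

section GammaIntegrals

lemma integrableOn_rpow_mul_exp_neg_mul {a r : ℝ} (ha : 0 < a) (hr : 0 < r) :
    IntegrableOn (fun u : ℝ => u ^ (a - 1) * Real.exp (-(r * u))) (Set.Ioi 0) := by
  simpa using integrableOn_rpow_mul_exp_neg_mul_rpow (s := a - 1) (p := 1) (b := r)
    (by linarith) one_pos hr

lemma lintegral_rpow_mul_exp_neg_mul {a r : ℝ} (ha : 0 < a) (hr : 0 < r) :
    ∫⁻ u in Set.Ioi (0 : ℝ), ENNReal.ofReal (u ^ (a - 1) * Real.exp (-(r * u))) =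
      ENNReal.ofReal ((1 / r) ^ a * Real.Gamma a) := by
  rw [← Real.integral_rpow_mul_exp_neg_mul_Ioi ha hr, ofReal_integral_eq_lintegral_ofReal
    (integrableOn_rpow_mul_exp_neg_mul ha hr)]
  filter_upwards [ae_restrict_mem measurableSet_Ioi] with u (hu : 0 < u)
  positivity

lemma lintegral_rpow_mul_exp_neg_div {a s : ℝ} (ha : 0 < a) (hs : 0 < s) :
    ∫⁻ u in Set.Ioi (0 : ℝ), ENNReal.ofReal (u ^ (-a - 1) * Real.exp (-(s / u))) =
      ENNReal.ofReal (Real.Gamma a * s ^ (-a)) := by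
  set g : ℝ → ℝ := fun v => v ^ (a - 1) * Real.exp (-(s * v))
  have inversion : Set.EqOn (fun u : ℝ => (|(-1 : ℝ)| * u ^ ((-1 : ℝ) - 1)) • g (u ^ (-1 : ℝ)))
      (fun u => u ^ (-a - 1) * Real.exp (-(s / u))) (Set.Ioi 0) := by
    intro u (hu : 0 < u)
    have exponents : u ^ ((-1 : ℝ) - 1) * u ^ (-1 * (a - 1)) = u ^ (-a - 1) := by
      rw [← Real.rpow_add hu]
      ring_nf
    simp only [g, smul_eq_mul, abs_neg, abs_one, one_mul]
    rw [← Real.rpow_mul hu.le, ← mul_assoc, exponents, Real.rpow_neg_one, div_eq_mul_inv]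
  have hg : IntegrableOn g (Set.Ioi 0) := integrableOn_rpow_mul_exp_neg_mul ha hs
  have hint := (integrableOn_Ioi_comp_rpow_iff g (by norm_num : (-1 : ℝ) ≠ 0)).2 hg
  rw [integrableOn_congr_fun inversion measurableSet_Ioi] at hint
  have hval : ∫ u in Set.Ioi (0 : ℝ), u ^ (-a - 1) * Real.exp (-(s / u)) =
      Real.Gamma a * s ^ (-a) := by
    rw [← setIntegral_congr_fun measurableSet_Ioi inversion,
      integral_comp_rpow_Ioi g (by norm_num : (-1 : ℝ) ≠ 0),
      Real.integral_rpow_mul_exp_neg_mul_Ioi ha hs, mul_comm, one_div, Real.inv_rpow hs.le,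
      Real.rpow_neg hs.le]
  rw [← hval, ofReal_integral_eq_lintegral_ofReal hint]
  filter_upwards [ae_restrict_mem measurableSet_Ioi] with u (hu : 0 < u)
  positivity

lemma ofReal_one_sub_exp_neg_div {c u : ℝ} (hc : 0 ≤ c) (hu : 0 < u) :
    ENNReal.ofReal (1 - Real.exp (-(c / u))) =
      ∫⁻ s in Set.Ioc 0 c, ENNReal.ofReal (u⁻¹ * Real.exp (-(s / u))) := by
  have hderiv : ∀ s ∈ Set.uIcc 0 c,
      HasDerivAt (fun s => -Real.exp (-(s / u))) (u⁻¹ * Real.exp (-(s / u))) s := by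
    intro s _
    convert! (((hasDerivAt_id s).div_const u).neg.exp).neg using 1
    simp [mul_comm]
  have hcont : Continuous fun s : ℝ => u⁻¹ * Real.exp (-(s / u)) := by fun_prop
  have hval := intervalIntegral.integral_eq_sub_of_hasDerivAt hderiv (hcont.intervalIntegrable _ _)
  rw [intervalIntegral.integral_of_le hc] at hval
  rw [← ofReal_integral_eq_lintegral_ofReal
    (hcont.integrableOn_Icc.mono_set Set.Ioc_subset_Icc_self)
    (ae_of_all _ fun s => by positivity), hval]
  simp [neg_add_eq_sub]

lemma lintegral_Ioc_const_mul_rpow {a b c : ℝ} (ha : 0 < a) (hb : 0 ≤ b) (hc : 0 ≤ c) :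
    ∫⁻ s in Set.Ioc 0 c, ENNReal.ofReal (b * s ^ (a - 1)) = ENNReal.ofReal (b / a * c ^ a) := by
  have hint : IntegrableOn (fun s : ℝ => b * s ^ (a - 1)) (Set.Ioc 0 c) :=
    (intervalIntegrable_iff_integrableOn_Ioc_of_le hc).1
      ((intervalIntegral.intervalIntegrable_rpow' (by linarith)).const_mul b)
  rw [← ofReal_integral_eq_lintegral_ofReal hint, integral_const_mul,
    ← intervalIntegral.integral_of_le hc, integral_rpow (Or.inl (by linarith)), sub_add_cancel,
    Real.zero_rpow ha.ne']
  · ring_nf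
  · filter_upwards [ae_restrict_mem measurableSet_Ioc] with s hs
    have := hs.1
    positivity

lemma lintegral_rpow_mul_one_sub_exp_neg_div {a c : ℝ} (ha₀ : 0 < a) (ha₁ : a < 1) (hc : 0 ≤ c) :
    ∫⁻ u in Set.Ioi (0 : ℝ), ENNReal.ofReal (u ^ (a - 1) * (1 - Real.exp (-(c / u)))) =
      ENNReal.ofReal (Real.Gamma (1 - a) / a * c ^ a) := by
  have expand : ∀ u ∈ Set.Ioi (0 : ℝ),
      ENNReal.ofReal (u ^ (a - 1) * (1 - Real.exp (-(c / u)))) =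
      ∫⁻ s in Set.Ioc 0 c, ENNReal.ofReal (u ^ (-(1 - a) - 1) * Real.exp (-(s / u))) := by
    intro u (hu : 0 < u)
    rw [ENNReal.ofReal_mul (by positivity), ofReal_one_sub_exp_neg_div hc hu,
      ← lintegral_const_mul _ (by fun_prop)]
    congr 1 with s
    rw [← ENNReal.ofReal_mul (by positivity), ← mul_assoc, ← Real.rpow_neg_one,
      ← Real.rpow_add hu]
    ring_nf
  have inner_integral : ∀ s ∈ Set.Ioc (0 : ℝ) c,
      ∫⁻ u in Set.Ioi (0 : ℝ), ENNReal.ofReal (u ^ (-(1 - a) - 1) * Real.exp (-(s / u))) =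
      ENNReal.ofReal (Real.Gamma (1 - a) * s ^ (a - 1)) := by
    intro s hs
    rw [lintegral_rpow_mul_exp_neg_div (by linarith) hs.1, neg_sub]
  have hGamma := Real.Gamma_pos_of_pos (sub_pos.2 ha₁)
  rw [setLIntegral_congr_fun measurableSet_Ioi expand, lintegral_lintegral_swap (by fun_prop),
    setLIntegral_congr_fun measurableSet_Ioc inner_integral,
    lintegral_Ioc_const_mul_rpow ha₀ hGamma.le hc]

lemma ofReal_div_rpow {b c x : ℝ} (hb : 0 < b) (hc : 0 ≤ c) (hx : 0 < x) :
    ENNReal.ofReal (c / x ^ b) =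
      ENNReal.ofReal (Real.Gamma b)⁻¹ * ∫⁻ u in Set.Ioi (0 : ℝ),
        ENNReal.ofReal (u ^ (b - 1)) * ENNReal.ofReal (Real.exp (-u * x) * c) := by
  have := Real.Gamma_pos_of_pos hb
  have factor : ∀ u ∈ Set.Ioi (0 : ℝ),
      ENNReal.ofReal (u ^ (b - 1)) * ENNReal.ofReal (Real.exp (-u * x) * c) =
      ENNReal.ofReal c * ENNReal.ofReal (u ^ (b - 1) * Real.exp (-(x * u))) := by
    intro u (hu : 0 < u)
    rw [← ENNReal.ofReal_mul (by positivity), ← ENNReal.ofReal_mul hc]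
    ring_nf
  rw [setLIntegral_congr_fun measurableSet_Ioi factor, lintegral_const_mul _ (by fun_prop),
    lintegral_rpow_mul_exp_neg_mul hb hx, one_div, Real.inv_rpow hx.le, ← ENNReal.ofReal_mul hc,
    ← ENNReal.ofReal_mul (by positivity)]
  congr 1
  field_simp

end GammaIntegrals

section RieszWeight

variable {V : Type*} [NormedAddCommGroup V] [InnerProductSpace ℝ V] [FiniteDimensional ℝ V]
  [MeasurableSpace V] [BorelSpace V]

lemma integral_exp_neg_mul_sq_norm_mul_cos {u : ℝ} (hu : 0 < u) (x : V) :
    ∫ t : V, Real.exp (-u * ‖t‖ ^ 2) * Real.cos (inner ℝ t x) =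
      (Real.pi / u) ^ ((finrank ℝ V : ℝ) / 2) * Real.exp (-(‖x‖ ^ 2 / 4 / u)) := by
  have hb : 0 < (u : ℂ).re := by simpa using hu
  have hint := GaussianFourier.integrable_cexp_neg_mul_sq_norm_add hb Complex.I x
  have hval :=
    congrArg Complex.re (GaussianFourier.integral_cexp_neg_mul_sq_norm_add hb Complex.I x)
  have value_real : (Real.pi / u : ℂ) ^ ((finrank ℝ V : ℂ) / 2) *
      Complex.exp (Complex.I ^ 2 * ‖x‖ ^ 2 / (4 * u)) =
      (((Real.pi / u) ^ ((finrank ℝ V : ℝ) / 2) * Real.exp (-(‖x‖ ^ 2 / 4 / u)) : ℝ) : ℂ) := by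
    push_cast
    rw [Complex.ofReal_cpow (by positivity), Complex.I_sq]
    push_cast
    congr 2
    field_simp
  rw [value_real, Complex.ofReal_re, ← RCLike.re_eq_complex_re, ← integral_re hint] at hval
  rw [← hval]
  congr 1 with t
  simp [Complex.exp_re, ← Complex.ofReal_pow, real_inner_comm]

lemma integrable_exp_neg_mul_sq_norm {u : ℝ} (hu : 0 < u) :
    Integrable fun t : V => Real.exp (-u * ‖t‖ ^ 2) := by
  refine (GaussianFourier.integrable_cexp_neg_mul_sq_norm_add (V := V) (b := (u : ℂ))
    (by simpa using hu) 0 0).norm.congr (ae_of_all _ fun t => ?_)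
  simp [Complex.norm_exp, ← Complex.ofReal_pow]

lemma lintegral_exp_neg_mul_sq_norm_mul_one_sub_cos {u : ℝ} (hu : 0 < u) (x : V) :
    ∫⁻ t : V, ENNReal.ofReal (Real.exp (-u * ‖t‖ ^ 2) * (1 - Real.cos (inner ℝ t x))) =
      ENNReal.ofReal
        ((Real.pi / u) ^ ((finrank ℝ V : ℝ) / 2) * (1 - Real.exp (-(‖x‖ ^ 2 / 4 / u)))) := by
  have hexp := integrable_exp_neg_mul_sq_norm (V := V) hu
  have hcos : Integrable fun t : V => Real.exp (-u * ‖t‖ ^ 2) * Real.cos (inner ℝ t x) :=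
    hexp.mul_bdd (c := 1) (Continuous.aestronglyMeasurable (by fun_prop))
      (ae_of_all _ fun t => by simpa using Real.abs_cos_le_one _)
  rw [← ofReal_integral_eq_lintegral_ofReal]
  · simp_rw [mul_sub, mul_one]
    rw [integral_sub hexp hcos, GaussianFourier.integral_rexp_neg_mul_sq_norm hu,
      integral_exp_neg_mul_sq_norm_mul_cos hu]
  · simp_rw [mul_sub, mul_one]
    exact hexp.sub hcos
  · exact ae_of_all _ fun t =>
      mul_nonneg (by positivity) (sub_nonneg.2 (Real.cos_le_one _))

lemma lintegral_rpow_mul_exp_neg_mul_sq_norm_mul_one_sub_cos (α : ℝ) {u : ℝ} (hu : 0 < u) (x : V) :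
    ∫⁻ t : V, ENNReal.ofReal (u ^ ((finrank ℝ V + α) / 2 - 1)) *
      ENNReal.ofReal (Real.exp (-u * ‖t‖ ^ 2) * (1 - Real.cos (inner ℝ t x))) =
      ENNReal.ofReal (Real.pi ^ ((finrank ℝ V : ℝ) / 2)) *
      ENNReal.ofReal (u ^ (α / 2 - 1) * (1 - Real.exp (-(‖x‖ ^ 2 / 4 / u)))) := by
  have power : u ^ (α / 2 - 1) =
      u ^ ((finrank ℝ V + α) / 2 - 1) / u ^ ((finrank ℝ V : ℝ) / 2) := by
    rw [← Real.rpow_sub hu]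
    ring_nf
  rw [lintegral_const_mul _ (by fun_prop), lintegral_exp_neg_mul_sq_norm_mul_one_sub_cos hu,
    ← ENNReal.ofReal_mul (by positivity), ← ENNReal.ofReal_mul (by positivity),
    Real.div_rpow Real.pi_pos.le hu.le, power]
  ring_nf

/-- The constant `C` for which `∫ (1 - cos ⟪t, x⟫) / ‖t‖ ^ (d + α) dt = C ‖x‖ ^ α` in dimension `d`,
for `0 < α < 2`. -/
noncomputable def rieszConst (d : ℕ) (α : ℝ) : ℝ :=
  Real.pi ^ ((d : ℝ) / 2) * Real.Gamma (1 - α / 2) /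
    (α / 2 * 2 ^ α * Real.Gamma ((d + α) / 2))

lemma rieszConst_pos (d : ℕ) {α : ℝ} (hα₀ : 0 < α) (hα₂ : α < 2) : 0 < rieszConst d α := by
  have := Real.Gamma_pos_of_pos (show 0 < 1 - α / 2 by linarith)
  have := Real.Gamma_pos_of_pos (show 0 < (d + α) / 2 by positivity)
  unfold rieszConst
  positivity

lemma rieszConst_one (d : ℕ) : rieszConst d 1 = normConst d := by
  have hpi : Real.pi ^ (((d : ℝ) + 1) / 2) = Real.pi ^ ((d : ℝ) / 2) * √Real.pi := by
    rw [Real.sqrt_eq_rpow, ← Real.rpow_add Real.pi_pos, add_div]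
  rw [rieszConst, normConst, hpi, Real.rpow_one, show (1 : ℝ) - 1 / 2 = 1 / 2 by norm_num,
    Real.Gamma_one_half_eq]
  norm_num

-- The power of the norm is a Laplace transform, which makes the integral over `t` Gaussian.
lemma lintegral_one_sub_cos_div_norm_rpow {α : ℝ} (hα₀ : 0 < α) (hα₂ : α < 2) (x : V) :
    ∫⁻ t : V, ENNReal.ofReal ((1 - Real.cos (inner ℝ t x)) / ‖t‖ ^ (finrank ℝ V + α)) =
      ENNReal.ofReal (rieszConst (finrank ℝ V) α * ‖x‖ ^ α) := by
  set b : ℝ := (finrank ℝ V + α) / 2 with hb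
  have hb_pos : 0 < b := by positivity
  have := Real.Gamma_pos_of_pos hb_pos
  have laplace (t : V) :
      ENNReal.ofReal ((1 - Real.cos (inner ℝ t x)) / ‖t‖ ^ (finrank ℝ V + α)) =
      ENNReal.ofReal (Real.Gamma b)⁻¹ * ∫⁻ u in Set.Ioi (0 : ℝ), ENNReal.ofReal (u ^ (b - 1)) *
        ENNReal.ofReal (Real.exp (-u * ‖t‖ ^ 2) * (1 - Real.cos (inner ℝ t x))) := by
    rcases eq_or_ne t 0 with rfl | ht
    · simp
    · rw [← ofReal_div_rpow hb_pos (sub_nonneg.2 (Real.cos_le_one _)) (by positivity),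
        ← Real.rpow_two, ← Real.rpow_mul (norm_nonneg t), hb, mul_div_cancel₀ _ two_ne_zero]
  have scale : (‖x‖ ^ 2 / 4) ^ (α / 2) = ‖x‖ ^ α / 2 ^ α := by
    rw [show ‖x‖ ^ 2 / 4 = (‖x‖ / 2) ^ (2 : ℝ) by rw [Real.rpow_two]; ring,
      ← Real.rpow_mul (by positivity), mul_div_cancel₀ _ two_ne_zero,
      Real.div_rpow (norm_nonneg x) zero_le_two]
  simp_rw [laplace]
  rw [lintegral_const_mul' _ _ (by finiteness), lintegral_lintegral_swap (by fun_prop),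
    setLIntegral_congr_fun measurableSet_Ioi fun u hu =>
      lintegral_rpow_mul_exp_neg_mul_sq_norm_mul_one_sub_cos α hu x,
    lintegral_const_mul _ (by fun_prop),
    lintegral_rpow_mul_one_sub_exp_neg_div (by positivity) (by linarith) (by positivity), scale,
    ← ENNReal.ofReal_mul (by positivity), ← ENNReal.ofReal_mul (by positivity), rieszConst,
    ← hb]
  congr 1
  field_simp

variable (V) in
/-- The measure on a Euclidean space with density proportional to `‖t‖ ^ (-(d + α))`, normalised so
that `∫ (1 - cos ⟪t, x⟫) = ‖x‖ ^ α`. For `α = 1` it is the weight in the definition of the distance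
covariance. -/
noncomputable def rieszWeight (α : ℝ) : Measure V :=
  volume.withDensity fun t =>
    ENNReal.ofReal (rieszConst (finrank ℝ V) α * ‖t‖ ^ (finrank ℝ V + α))⁻¹

instance (α : ℝ) : SFinite (rieszWeight V α) := by
  unfold rieszWeight
  infer_instance

instance (α : ℝ) : (rieszWeight V α).IsNegInvariant := by
  refine ⟨?_⟩
  ext s hs
  rw [Measure.neg_def, Measure.map_apply measurable_neg hs, rieszWeight, withDensity_apply _ hs,
    withDensity_apply _ (measurable_neg hs),
    ← (Measure.measurePreserving_neg volume).setLIntegral_comp_preimage hs (by fun_prop)]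
  simp only [norm_neg]

lemma lintegral_rieszWeight (α : ℝ) (g : V → ℝ≥0∞) :
    ∫⁻ t, g t ∂rieszWeight V α =
      ∫⁻ t, ENNReal.ofReal (rieszConst (finrank ℝ V) α * ‖t‖ ^ (finrank ℝ V + α))⁻¹ * g t :=
  lintegral_withDensity_eq_lintegral_mul_non_measurable _ (by fun_prop)
    (ae_of_all _ fun _ => ENNReal.ofReal_lt_top) g

variable {α : ℝ}

lemma lintegral_one_sub_cos_rieszWeight (hα₀ : 0 < α) (hα₂ : α < 2) (x : V) :
    ∫⁻ t, ENNReal.ofReal (1 - Real.cos (inner ℝ t x)) ∂rieszWeight V α =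
      ENNReal.ofReal (‖x‖ ^ α) := by
  have hC := rieszConst_pos (finrank ℝ V) hα₀ hα₂
  have normalise (t : V) :
      ENNReal.ofReal (rieszConst (finrank ℝ V) α * ‖t‖ ^ (finrank ℝ V + α))⁻¹ *
        ENNReal.ofReal (1 - Real.cos (inner ℝ t x)) =
      ENNReal.ofReal (rieszConst (finrank ℝ V) α)⁻¹ *
        ENNReal.ofReal ((1 - Real.cos (inner ℝ t x)) / ‖t‖ ^ (finrank ℝ V + α)) := by
    rw [← ENNReal.ofReal_mul (by positivity), ← ENNReal.ofReal_mul (by positivity)]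
    congr 1
    rw [mul_inv]
    ring
  simp_rw [lintegral_rieszWeight, normalise]
  rw [lintegral_const_mul' _ _ ENNReal.ofReal_ne_top, lintegral_one_sub_cos_div_norm_rpow hα₀ hα₂,
    ← ENNReal.ofReal_mul (by positivity), inv_mul_cancel_left₀ hC.ne']

lemma integrable_one_sub_cos_rieszWeight (hα₀ : 0 < α) (hα₂ : α < 2) (x : V) :
    Integrable (fun t => 1 - Real.cos (inner ℝ t x)) (rieszWeight V α) := by
  refine ⟨Continuous.aestronglyMeasurable (by fun_prop), ?_⟩
  rw [hasFiniteIntegral_iff_ofReal (ae_of_all _ fun t => sub_nonneg.2 (Real.cos_le_one _)),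
    lintegral_one_sub_cos_rieszWeight hα₀ hα₂]
  exact ENNReal.ofReal_lt_top

lemma integral_one_sub_cos_rieszWeight (hα₀ : 0 < α) (hα₂ : α < 2) (x : V) :
    ∫ t, (1 - Real.cos (inner ℝ t x)) ∂rieszWeight V α = ‖x‖ ^ α := by
  rw [integral_eq_lintegral_of_nonneg_ae (ae_of_all _ fun t => sub_nonneg.2 (Real.cos_le_one _))
    (Continuous.aestronglyMeasurable (by fun_prop)), lintegral_one_sub_cos_rieszWeight hα₀ hα₂,
    ENNReal.toReal_ofReal (by positivity)]

end RieszWeight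

section NegativeType

variable {A B S T : Type*}

/-- The difference of a function at the two points of a pair. -/
def pairDiff (u : S → ℂ) (a : S × S) : ℂ := u a.1 - u a.2

/-- The mixed second difference of a kernel at two pairs of points. -/
def mixedDiff (d : S → S → ℝ) (a b : S × S) : ℝ := d a.1 b.1 - d a.1 b.2 - d a.2 b.1 + d a.2 b.2

lemma re_pairDiff_mul_conj (u : S → ℂ) (a b : S × S) :
    (pairDiff u a * conj (pairDiff u b)).re =
      2⁻¹ * (‖pairDiff u (a.1, b.2)‖ ^ 2 - ‖pairDiff u (a.1, b.1)‖ ^ 2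
        - ‖pairDiff u (a.2, b.2)‖ ^ 2 + ‖pairDiff u (a.2, b.1)‖ ^ 2) := by
  simp only [pairDiff, Complex.sq_norm, Complex.normSq_apply, Complex.mul_re, Complex.conj_re,
    Complex.conj_im, Complex.sub_re, Complex.sub_im]
  ring

variable [MeasurableSpace A] [MeasurableSpace B] [MeasurableSpace S] [MeasurableSpace T]

/-- A representation of the kernel `d` as half of a squared distance in `L²(α)`, where the point `x`
is sent to the function `s ↦ f s x`. Only differences of such functions need to be square
integrable, and their inner products are required to be real. Schoenberg: such kernels are of
negative type. -/
structure NegTypeRepresentation (α : Measure A) (f : A → S → ℂ) (d : S → S → ℝ) : Prop where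
  measurable : Measurable (Function.uncurry f)
  integrable_norm_sq : ∀ a, Integrable (fun s => ‖pairDiff (f s) a‖ ^ 2) α
  integral_norm_sq : ∀ a, ∫ s, ‖pairDiff (f s) a‖ ^ 2 ∂α = 2 * d a.1 a.2
  integral_im : ∀ a b, (∫ s, pairDiff (f s) a * conj (pairDiff (f s) b) ∂α).im = 0

namespace NegTypeRepresentation

variable {α : Measure A} {β : Measure B} {f : A → S → ℂ} {g : B → S → ℂ} {d e : S → S → ℝ}

lemma comp (hf : NegTypeRepresentation α f d) {φ : T → S} (hφ : Measurable φ) :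
    NegTypeRepresentation α (fun s x => f s (φ x)) (fun x y => d (φ x) (φ y)) where
  measurable := hf.measurable.comp (measurable_fst.prodMk (hφ.comp measurable_snd))
  integrable_norm_sq a := hf.integrable_norm_sq (φ a.1, φ a.2)
  integral_norm_sq a := hf.integral_norm_sq (φ a.1, φ a.2)
  integral_im a b := hf.integral_im (φ a.1, φ a.2) (φ b.1, φ b.2)

lemma measurable_pairDiff (hf : NegTypeRepresentation α f d) {φ : T → A} {ψ : T → S × S}
    (hφ : Measurable φ) (hψ : Measurable ψ) : Measurable fun x => pairDiff (f (φ x)) (ψ x) :=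
  (hf.measurable.comp (hφ.prodMk hψ.fst)).sub (hf.measurable.comp (hφ.prodMk hψ.snd))

lemma integrable_pairDiff_mul_conj (hf : NegTypeRepresentation α f d) (a b : S × S) :
    Integrable (fun s => pairDiff (f s) a * conj (pairDiff (f s) b)) α := by
  have hmem (c : S × S) : MemLp (fun s => pairDiff (f s) c) 2 α :=
    (memLp_two_iff_integrable_sq_norm
      (hf.measurable_pairDiff measurable_id measurable_const).aestronglyMeasurable).2
      (hf.integrable_norm_sq c)
  exact (hmem a).integrable_mul (hmem b).star

lemma integral_pairDiff_mul_conj (hf : NegTypeRepresentation α f d) (a b : S × S) :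
    ∫ s, pairDiff (f s) a * conj (pairDiff (f s) b) ∂α = (-mixedDiff d a b : ℝ) := by
  have hint := hf.integrable_norm_sq
  refine Complex.ext ?_ (by rw [hf.integral_im, Complex.ofReal_im])
  rw [← RCLike.re_eq_complex_re, ← integral_re (hf.integrable_pairDiff_mul_conj a b)]
  simp only [RCLike.re_eq_complex_re, re_pairDiff_mul_conj, Complex.ofReal_re]
  rw [integral_const_mul, integral_add (((hint _).sub' (hint _)).sub' (hint _)) (hint _),
    integral_sub ((hint _).sub' (hint _)) (hint _), integral_sub (hint _) (hint _)]
  simp only [hf.integral_norm_sq, mixedDiff]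
  ring

end NegTypeRepresentation

end NegativeType

section Wave

variable {V : Type*} [NormedAddCommGroup V] [InnerProductSpace ℝ V]

/-- The plane wave with frequency `s`. -/
noncomputable def wave (s x : V) : ℂ := Complex.exp (Complex.I * ((inner ℝ s x : ℝ) : ℂ))

lemma norm_wave (s x : V) : ‖wave s x‖ = 1 := by
  simp [wave, Complex.norm_exp]

lemma conj_wave (s x : V) : conj (wave s x) = wave (-s) x := by
  simp [wave, ← Complex.exp_conj]

lemma conj_pairDiff_wave (s : V) (a : V × V) :
    conj (pairDiff (wave s) a) = pairDiff (wave (-s)) a := by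
  simp [pairDiff, conj_wave]

lemma norm_pairDiff_wave_sq (s : V) (a : V × V) :
    ‖pairDiff (wave s) a‖ ^ 2 = 2 * (1 - Real.cos (inner ℝ s (a.1 - a.2))) := by
  rw [inner_sub_right, Real.cos_sub, pairDiff, wave, wave, mul_comm Complex.I, mul_comm Complex.I,
    Complex.sq_norm, Complex.normSq_apply, Complex.sub_re, Complex.sub_im,
    Complex.exp_ofReal_mul_I_re, Complex.exp_ofReal_mul_I_re, Complex.exp_ofReal_mul_I_im,
    Complex.exp_ofReal_mul_I_im]
  linear_combination Real.sin_sq_add_cos_sq (inner ℝ s a.1) + Real.sin_sq_add_cos_sq (inner ℝ s a.2)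

variable [MeasurableSpace V] [BorelSpace V]

@[fun_prop]
lemma measurable_wave [SecondCountableTopology V] {T : Type*} [MeasurableSpace T] {φ ψ : T → V}
    (hφ : Measurable φ) (hψ : Measurable ψ) : Measurable fun x => wave (φ x) (ψ x) := by
  unfold wave
  fun_prop

lemma negTypeRepresentation_wave [FiniteDimensional ℝ V] {α : ℝ} (hα₀ : 0 < α) (hα₂ : α < 2) :
    NegTypeRepresentation (rieszWeight V α) wave (fun x y => ‖x - y‖ ^ α) where
  measurable := measurable_wave measurable_fst measurable_snd
  integrable_norm_sq a := by
    simp_rw [norm_pairDiff_wave_sq]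
    exact (integrable_one_sub_cos_rieszWeight hα₀ hα₂ _).const_mul 2
  integral_norm_sq a := by
    simp_rw [norm_pairDiff_wave_sq]
    rw [integral_const_mul, integral_one_sub_cos_rieszWeight hα₀ hα₂]
  -- Conjugating a wave negates its frequency, and the weight is even.
  integral_im a b := by
    rw [← Complex.conj_eq_iff_im, ← integral_conj, ← integral_neg_eq_self]
    simp [conj_pairDiff_wave]

lemma negTypeRepresentation_wave_one [FiniteDimensional ℝ V] :
    NegTypeRepresentation (rieszWeight V 1) wave (fun x y => ‖x - y‖) := by
  simpa only [Real.rpow_one] using negTypeRepresentation_wave (V := V) one_pos one_lt_two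

end Wave

section Product

variable {A B S : Type*} {f : A → S → ℂ} {g : B → S → ℂ}

/-- The integrand of the Fubini argument: its integral over the pairs of points is a squared
covariance, its integral over the parameters is a product of mixed differences. -/
noncomputable def pairDiffProd (f : A → S → ℂ) (g : B → S → ℂ) (p : A × B)
    (ab : (S × S) × (S × S)) : ℂ :=
  pairDiff (f p.1) ab.1 * conj (pairDiff (f p.1) ab.2) *
    (pairDiff (g p.2) ab.1 * conj (pairDiff (g p.2) ab.2))

lemma norm_pairDiffProd_le (p : A × B) (ab : (S × S) × (S × S)) :
    ‖pairDiffProd f g p ab‖ ≤ ‖pairDiff (f p.1) ab.1‖ ^ 2 * ‖pairDiff (g p.2) ab.2‖ ^ 2 +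
      ‖pairDiff (f p.1) ab.2‖ ^ 2 * ‖pairDiff (g p.2) ab.1‖ ^ 2 := by
  simp only [pairDiffProd, norm_mul, RCLike.norm_conj]
  nlinarith [sq_nonneg (‖pairDiff (f p.1) ab.1‖ * ‖pairDiff (g p.2) ab.2‖ -
      ‖pairDiff (f p.1) ab.2‖ * ‖pairDiff (g p.2) ab.1‖),
    sq_nonneg (‖pairDiff (f p.1) ab.1‖ * ‖pairDiff (g p.2) ab.2‖),
    sq_nonneg (‖pairDiff (f p.1) ab.2‖ * ‖pairDiff (g p.2) ab.1‖)]

end Product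

section Covariance

variable {S : Type*} [MeasurableSpace S] (μ : Measure S)

/-- The bilinear (not sesquilinear) covariance of two complex functions. -/
noncomputable def bilinCov (u v : S → ℂ) : ℂ :=
  ∫ x, u x * v x ∂μ - (∫ x, u x ∂μ) * ∫ x, v x ∂μ

variable {μ} [IsProbabilityMeasure μ]

lemma integral_pairDiff_mul_pairDiff {u v : S → ℂ} (hu : MemLp u 2 μ) (hv : MemLp v 2 μ) :
    ∫ a, pairDiff u a * pairDiff v a ∂(μ.prod μ) = 2 * bilinCov μ u v := by
  have huv : Integrable (fun x => u x * v x) μ := hu.integrable_mul hv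
  have hu₁ := hu.integrable one_le_two
  have hv₁ := hv.integrable one_le_two
  have expand (a : S × S) : pairDiff u a * pairDiff v a =
      u a.1 * v a.1 - u a.1 * v a.2 - v a.1 * u a.2 + u a.2 * v a.2 := by
    simp only [pairDiff]
    ring
  have hint₁ : Integrable (fun a : S × S => u a.1 * v a.1) (μ.prod μ) := huv.comp_fst μ
  have hint₂ : Integrable (fun a : S × S => u a.1 * v a.2) (μ.prod μ) := hu₁.mul_prod hv₁
  have hint₃ : Integrable (fun a : S × S => v a.1 * u a.2) (μ.prod μ) := hv₁.mul_prod hu₁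
  have hint₄ : Integrable (fun a : S × S => u a.2 * v a.2) (μ.prod μ) := huv.comp_snd μ
  simp_rw [expand]
  rw [integral_add ((hint₁.sub' hint₂).sub' hint₃) hint₄, integral_sub (hint₁.sub' hint₂) hint₃,
    integral_sub hint₁ hint₂, integral_prod_mul, integral_prod_mul,
    integral_fun_fst (fun x => u x * v x), integral_fun_snd (fun x => u x * v x), bilinCov,
    probReal_univ, one_smul]
  ring

variable {A B : Type*} {f : A → S → ℂ} {g : B → S → ℂ}

lemma integral_pairDiffProd_right {p : A × B}
    (hfμ : MemLp (f p.1) 2 μ) (hgμ : MemLp (g p.2) 2 μ) :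
    ∫ ab, pairDiffProd f g p ab ∂((μ.prod μ).prod (μ.prod μ)) =
      (4 * ‖bilinCov μ (f p.1) (g p.2)‖ ^ 2 : ℝ) := by
  have regroup (ab : (S × S) × (S × S)) : pairDiffProd f g p ab =
      pairDiff (f p.1) ab.1 * pairDiff (g p.2) ab.1 *
        conj (pairDiff (f p.1) ab.2 * pairDiff (g p.2) ab.2) := by
    rw [pairDiffProd, map_mul]
    ring
  simp_rw [regroup]
  rw [integral_prod_mul (fun a => pairDiff (f p.1) a * pairDiff (g p.2) a)
      (fun b => conj (pairDiff (f p.1) b * pairDiff (g p.2) b)), integral_conj,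
    integral_pairDiff_mul_pairDiff hfμ hgμ, Complex.mul_conj, Complex.normSq_eq_norm_sq, norm_mul,
    mul_pow]
  norm_num

end Covariance

namespace NegTypeRepresentation

variable {A B S : Type*} [MeasurableSpace A] [MeasurableSpace B] [MeasurableSpace S]
  {α : Measure A} {β : Measure B} {f : A → S → ℂ} {g : B → S → ℂ} {d e : S → S → ℝ}
  {μ : Measure S}

lemma integral_pairDiffProd_left [SFinite α] [SFinite β] (hf : NegTypeRepresentation α f d)
    (hg : NegTypeRepresentation β g e) (ab : (S × S) × (S × S)) :
    ∫ p, pairDiffProd f g p ab ∂(α.prod β) =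
      (mixedDiff d ab.1 ab.2 * mixedDiff e ab.1 ab.2 : ℝ) := by
  have hprod := integral_prod_mul (μ := α) (ν := β)
    (fun s => pairDiff (f s) ab.1 * conj (pairDiff (f s) ab.2))
    (fun t => pairDiff (g t) ab.1 * conj (pairDiff (g t) ab.2))
  rw [hf.integral_pairDiff_mul_conj, hg.integral_pairDiff_mul_conj, ← Complex.ofReal_mul,
    neg_mul_neg] at hprod
  exact hprod

lemma integrable_norm_sq_mul_norm_sq [SFinite α] [SFinite β] [SFinite μ]
    (hf : NegTypeRepresentation α f d) (hg : NegTypeRepresentation β g e)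
    (hd : Integrable (Function.uncurry d) (μ.prod μ))
    (he : Integrable (Function.uncurry e) (μ.prod μ)) :
    Integrable (fun z : (A × B) × ((S × S) × (S × S)) =>
      ‖pairDiff (f z.1.1) z.2.1‖ ^ 2 * ‖pairDiff (g z.1.2) z.2.2‖ ^ 2)
      ((α.prod β).prod ((μ.prod μ).prod (μ.prod μ))) := by
  have hmeas : Measurable fun z : (A × B) × ((S × S) × (S × S)) =>
      ‖pairDiff (f z.1.1) z.2.1‖ ^ 2 * ‖pairDiff (g z.1.2) z.2.2‖ ^ 2 :=
    ((hf.measurable_pairDiff (by fun_prop) (by fun_prop)).norm.pow_const 2).mul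
      ((hg.measurable_pairDiff (by fun_prop) (by fun_prop)).norm.pow_const 2)
  refine (integrable_prod_iff' hmeas.aestronglyMeasurable).2 ⟨ae_of_all _ fun ab =>
    (hf.integrable_norm_sq ab.1).mul_prod (hg.integrable_norm_sq ab.2), ?_⟩
  have inner_integral (ab : (S × S) × (S × S)) :
      ∫ p, ‖‖pairDiff (f p.1) ab.1‖ ^ 2 * ‖pairDiff (g p.2) ab.2‖ ^ 2‖ ∂(α.prod β) =
      2 * d ab.1.1 ab.1.2 * (2 * e ab.2.1 ab.2.2) := by
    simp_rw [norm_mul, norm_pow, norm_norm]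
    rw [integral_prod_mul (fun s => ‖pairDiff (f s) ab.1‖ ^ 2)
      (fun t => ‖pairDiff (g t) ab.2‖ ^ 2), hf.integral_norm_sq, hg.integral_norm_sq]
  simp_rw [inner_integral]
  exact (hd.const_mul 2).mul_prod (he.const_mul 2)

lemma integrable_pairDiffProd [SFinite α] [SFinite β] [SFinite μ]
    (hf : NegTypeRepresentation α f d) (hg : NegTypeRepresentation β g e)
    (hd : Integrable (Function.uncurry d) (μ.prod μ))
    (he : Integrable (Function.uncurry e) (μ.prod μ)) :
    Integrable (Function.uncurry (pairDiffProd f g))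
      ((α.prod β).prod ((μ.prod μ).prod (μ.prod μ))) := by
  have hstraight := integrable_norm_sq_mul_norm_sq hf hg hd he
  have hcrossed := ((MeasurePreserving.id (α.prod β)).prod
    (Measure.measurePreserving_swap (μ := μ.prod μ) (ν := μ.prod μ))).integrable_comp_of_integrable
    hstraight
  have hmeas : Measurable (Function.uncurry (pairDiffProd f g)) := by
    have hf₁ := hf.measurable_pairDiff (T := (A × B) × ((S × S) × (S × S)))
      (φ := fun z => z.1.1) (ψ := fun z => z.2.1) (by fun_prop) (by fun_prop)
    have hf₂ := hf.measurable_pairDiff (T := (A × B) × ((S × S) × (S × S)))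
      (φ := fun z => z.1.1) (ψ := fun z => z.2.2) (by fun_prop) (by fun_prop)
    have hg₁ := hg.measurable_pairDiff (T := (A × B) × ((S × S) × (S × S)))
      (φ := fun z => z.1.2) (ψ := fun z => z.2.1) (by fun_prop) (by fun_prop)
    have hg₂ := hg.measurable_pairDiff (T := (A × B) × ((S × S) × (S × S)))
      (φ := fun z => z.1.2) (ψ := fun z => z.2.2) (by fun_prop) (by fun_prop)
    exact (hf₁.mul (Complex.continuous_conj.measurable.comp hf₂)).mul
      (hg₁.mul (Complex.continuous_conj.measurable.comp hg₂))
  exact (hstraight.add hcrossed).mono' hmeas.aestronglyMeasurable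
    (ae_of_all _ fun z => norm_pairDiffProd_le z.1 z.2)

lemma integrable_mixedDiff_mul [SFinite α] [SFinite β] [SFinite μ]
    (hf : NegTypeRepresentation α f d) (hg : NegTypeRepresentation β g e)
    (hd : Integrable (Function.uncurry d) (μ.prod μ))
    (he : Integrable (Function.uncurry e) (μ.prod μ)) :
    Integrable (fun ab : (S × S) × (S × S) => mixedDiff d ab.1 ab.2 * mixedDiff e ab.1 ab.2)
      ((μ.prod μ).prod (μ.prod μ)) := by
  have h := (integrable_pairDiffProd hf hg hd he).integral_prod_right
  simp only [Function.uncurry_apply_pair, integral_pairDiffProd_left hf hg] at h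
  exact h.re

lemma measurable_bilinCov [SFinite μ] (hf : NegTypeRepresentation α f d)
    (hg : NegTypeRepresentation β g e) :
    Measurable fun p : A × B => bilinCov μ (f p.1) (g p.2) := by
  have hmeas₁ : Measurable fun r : (A × B) × S => f r.1.1 r.2 :=
    hf.measurable.comp (g := Function.uncurry f) (f := fun r : (A × B) × S => (r.1.1, r.2))
      (by fun_prop)
  have hmeas₂ : Measurable fun r : (A × B) × S => g r.1.2 r.2 :=
    hg.measurable.comp (g := Function.uncurry g) (f := fun r : (A × B) × S => (r.1.2, r.2))
      (by fun_prop)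
  have hint {F : (A × B) × S → ℂ} (hF : Measurable F) : Measurable fun p => ∫ x, F (p, x) ∂μ :=
    hF.stronglyMeasurable.integral_prod_right'.measurable
  exact (hint (hmeas₁.mul hmeas₂)).sub ((hint hmeas₁).mul (hint hmeas₂))

section Probability

variable [SFinite α] [SFinite β] [IsProbabilityMeasure μ]

lemma integral_norm_bilinCov_sq (hf : NegTypeRepresentation α f d)
    (hg : NegTypeRepresentation β g e)
    (hd : Integrable (Function.uncurry d) (μ.prod μ))
    (he : Integrable (Function.uncurry e) (μ.prod μ))
    (hfμ : ∀ s, MemLp (f s) 2 μ) (hgμ : ∀ t, MemLp (g t) 2 μ) :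
    ∫ p, ‖bilinCov μ (f p.1) (g p.2)‖ ^ 2 ∂(α.prod β) =
      (∫ ab, mixedDiff d ab.1 ab.2 * mixedDiff e ab.1 ab.2 ∂((μ.prod μ).prod (μ.prod μ))) / 4 := by
  have fubini := integral_integral_swap (integrable_pairDiffProd hf hg hd he)
  simp only [integral_pairDiffProd_left hf hg, integral_pairDiffProd_right (hfμ _) (hgμ _),
    integral_complex_ofReal, Complex.ofReal_inj, integral_const_mul] at fubini
  linarith

lemma integral_mixedDiff_mul_nonneg (hf : NegTypeRepresentation α f d)
    (hg : NegTypeRepresentation β g e)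
    (hd : Integrable (Function.uncurry d) (μ.prod μ))
    (he : Integrable (Function.uncurry e) (μ.prod μ))
    (hfμ : ∀ s, MemLp (f s) 2 μ) (hgμ : ∀ t, MemLp (g t) 2 μ) :
    0 ≤ ∫ ab, mixedDiff d ab.1 ab.2 * mixedDiff e ab.1 ab.2 ∂((μ.prod μ).prod (μ.prod μ)) := by
  have h := integral_norm_bilinCov_sq hf hg hd he hfμ hgμ
  have : 0 ≤ ∫ p, ‖bilinCov μ (f p.1) (g p.2)‖ ^ 2 ∂(α.prod β) :=
    integral_nonneg fun p => by positivity
  linarith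

lemma lintegral_norm_bilinCov_sq (hf : NegTypeRepresentation α f d)
    (hg : NegTypeRepresentation β g e)
    (hd : Integrable (Function.uncurry d) (μ.prod μ))
    (he : Integrable (Function.uncurry e) (μ.prod μ))
    (hfμ : ∀ s, MemLp (f s) 2 μ) (hgμ : ∀ t, MemLp (g t) 2 μ) :
    ∫⁻ s, ∫⁻ t, ENNReal.ofReal (‖bilinCov μ (f s) (g t)‖ ^ 2) ∂β ∂α =
      ENNReal.ofReal ((∫ ab, mixedDiff d ab.1 ab.2 * mixedDiff e ab.1 ab.2
        ∂((μ.prod μ).prod (μ.prod μ))) / 4) := by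
  have hmeas := ((measurable_bilinCov (μ := μ) hf hg).norm.pow_const 2).ennreal_ofReal
  have hint : Integrable (fun p : A × B => ‖bilinCov μ (f p.1) (g p.2)‖ ^ 2) (α.prod β) := by
    have h := (integrable_pairDiffProd hf hg hd he).integral_prod_left
    simp only [Function.uncurry_apply_pair, integral_pairDiffProd_right (hfμ _) (hgμ _)] at h
    simpa only [RCLike.re_eq_complex_re, Complex.ofReal_re,
      inv_mul_cancel_left₀ (four_ne_zero' ℝ)] using h.re.const_mul 4⁻¹
  rw [← lintegral_prod _ hmeas.aemeasurable,
    ← ofReal_integral_eq_lintegral_ofReal hint (ae_of_all _ fun p => by positivity),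
    integral_norm_bilinCov_sq hf hg hd he hfμ hgμ]

end Probability

end NegTypeRepresentation

section DcovSq

variable {p q : ℕ}

lemma lintegral_rieszWeight_one (g : EuclideanSpace ℝ (Fin p) → ℝ≥0∞) :
    ∫⁻ t, g t ∂rieszWeight _ 1 =
      ∫⁻ t, ENNReal.ofReal (normConst p * ‖t‖ ^ (p + 1))⁻¹ * g t := by
  rw [lintegral_rieszWeight, rieszConst_one, finrank_euclideanSpace_fin]
  norm_cast

lemma dcovSq_eq_lintegral_bilinCov {Ω : Type*} [MeasurableSpace Ω] {P : Measure Ω}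
    {X : Ω → EuclideanSpace ℝ (Fin p)} {Y : Ω → EuclideanSpace ℝ (Fin q)} (hX : Measurable X)
    (hY : Measurable Y) :
    dcovSq P X Y = ∫⁻ s, ∫⁻ t, ENNReal.ofReal (‖bilinCov (P.map fun ω => (X ω, Y ω))
      (fun z => wave s z.1) (fun z => wave t z.2)‖ ^ 2) ∂rieszWeight _ 1 ∂rieszWeight _ 1 := by
  have charFun_eq (s t) : bilinCov (P.map fun ω => (X ω, Y ω))
      (fun z => wave s z.1) (fun z => wave t z.2) =
      jointCharFun P X Y s t - jointCharFun P X Y s 0 * jointCharFun P X Y 0 t := by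
    have transfer {F : EuclideanSpace ℝ (Fin p) × EuclideanSpace ℝ (Fin q) → ℂ}
        (hF : Measurable F) : ∫ z, F z ∂(P.map fun ω => (X ω, Y ω)) = ∫ ω, F (X ω, Y ω) ∂P :=
      integral_map (by fun_prop) hF.aestronglyMeasurable
    rw [bilinCov, transfer (by fun_prop), transfer (by fun_prop), transfer (by fun_prop)]
    simp [jointCharFun, wave, Complex.exp_add]
  have hpos (n : ℕ) : 0 < normConst n := by
    rw [← rieszConst_one]
    exact rieszConst_pos n one_pos one_lt_two
  have hp := hpos p
  have hq := hpos q
  rw [lintegral_rieszWeight_one, dcovSq, ← lintegral_const_mul' _ _ ENNReal.ofReal_ne_top]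
  refine lintegral_congr fun s => ?_
  rw [lintegral_rieszWeight_one, ← lintegral_const_mul' _ _ ENNReal.ofReal_ne_top,
    ← lintegral_const_mul' _ _ ENNReal.ofReal_ne_top]
  refine lintegral_congr fun t => ?_
  rw [charFun_eq, ← ENNReal.ofReal_mul (by positivity), ← ENNReal.ofReal_mul (by positivity),
    ← ENNReal.ofReal_mul (by positivity)]
  congr 1
  rw [mul_inv, mul_inv]
  ring

end DcovSq

section PermFour

lemma sum_perm_four_reindex (F : Fin 4 → Fin 4 → Fin 4 → Fin 4 → ℝ) (τ : Equiv.Perm (Fin 4)) :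
    ∑ σ : Equiv.Perm (Fin 4), F (σ (τ 0)) (σ (τ 1)) (σ (τ 2)) (σ (τ 3)) =
      ∑ σ : Equiv.Perm (Fin 4), F (σ 0) (σ 1) (σ 2) (σ 3) :=
  Equiv.sum_comp (Equiv.mulRight τ) fun σ : Equiv.Perm (Fin 4) => F (σ 0) (σ 1) (σ 2) (σ 3)

variable (d e : Fin 4 → Fin 4 → ℝ)

lemma sum_perm_four_mixedDiff_mul_mixedDiff :
    ∑ σ : Equiv.Perm (Fin 4),
        mixedDiff d (σ 0, σ 3) (σ 1, σ 2) * mixedDiff e (σ 0, σ 3) (σ 1, σ 2) =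
      4 * ∑ σ : Equiv.Perm (Fin 4), d (σ 0) (σ 1) * mixedDiff e (σ 0, σ 3) (σ 1, σ 2) := by
  have reindex := sum_perm_four_reindex fun i j k l => d i j * mixedDiff e (i, l) (j, k)
  have swap_right := reindex (Equiv.swap 1 2)
  have swap_left := reindex (Equiv.swap 0 3)
  have swap_both := reindex (Equiv.swap 0 3 * Equiv.swap 1 2)
  simp only [Equiv.Perm.mul_apply, Equiv.swap_apply_def, Fin.reduceEq, if_true, if_false, mixedDiff,
    mul_add, mul_sub, add_mul, sub_mul, Finset.sum_add_distrib, Finset.sum_sub_distrib]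
    at swap_right swap_left swap_both ⊢
  linarith

variable {d e}

lemma sum_perm_four_mul_mixedDiff (hd : ∀ i j, d i j = d j i) (he : ∀ i j, e i j = e j i) :
    ∑ σ : Equiv.Perm (Fin 4), d (σ 0) (σ 1) * mixedDiff e (σ 0, σ 3) (σ 1, σ 2) =
      ∑ σ : Equiv.Perm (Fin 4), (d (σ 0) (σ 1) * e (σ 0) (σ 1)
        - 2 * (d (σ 0) (σ 1) * e (σ 0) (σ 2)) + d (σ 0) (σ 1) * e (σ 2) (σ 3)) := by
  have crossed : ∑ σ : Equiv.Perm (Fin 4), d (σ 0) (σ 1) * e (σ 3) (σ 1) =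
      ∑ σ : Equiv.Perm (Fin 4), d (σ 0) (σ 1) * e (σ 0) (σ 2) := by
    rw [← sum_perm_four_reindex (fun i j k _ => d i j * e i k) (Equiv.swap 0 1 * Equiv.swap 2 3)]
    refine Finset.sum_congr rfl fun σ _ => ?_
    simp [Equiv.swap_apply_def, hd (σ 1), he (σ 1)]
  have symm (σ : Equiv.Perm (Fin 4)) : e (σ 3) (σ 2) = e (σ 2) (σ 3) := he _ _
  simp only [mixedDiff, mul_add, mul_sub, Finset.sum_add_distrib, Finset.sum_sub_distrib,
    ← Finset.mul_sum, crossed, symm]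
  ring

end PermFour

section Pi

variable {S ι : Type*} [MeasurableSpace S] [Fintype ι] (μ : Measure S) [IsProbabilityMeasure μ]

lemma iIndepFun_eval_pi : iIndepFun (fun (i : ι) (z : ι → S) => z i) (Measure.pi fun _ => μ) :=
  iIndepFun_pi (X := fun _ x => x) fun _ => aemeasurable_id

lemma map_pi_pair {i j : ι} (hij : i ≠ j) :
    (Measure.pi fun _ : ι => μ).map (fun z => (z i, z j)) = μ.prod μ := by
  rw [((iIndepFun_eval_pi μ).indepFun hij).map_prod_eq_prod_map_map
    (measurable_pi_apply i).aemeasurable (measurable_pi_apply j).aemeasurable,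
    (measurePreserving_eval _ i).map_eq, (measurePreserving_eval _ j).map_eq]

lemma measurePreserving_pi_pair_pair {i j k l : ι} (hij : i ≠ j) (hkl : k ≠ l) (hik : i ≠ k)
    (hil : i ≠ l) (hjk : j ≠ k) (hjl : j ≠ l) :
    MeasurePreserving (fun z : ι → S => ((z i, z j), (z k, z l))) (Measure.pi fun _ => μ)
      ((μ.prod μ).prod (μ.prod μ)) where
  measurable := by fun_prop
  map_eq := by
    rw [((iIndepFun_eval_pi μ).indepFun_prodMk_prodMk (by fun_prop) i j k l hik hil hjk
      hjl).map_prod_eq_prod_map_map (by fun_prop) (by fun_prop), map_pi_pair μ hij,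
      map_pi_pair μ hkl]

end Pi

section Kernel

variable {p q : ℕ}

/-- The distance of the first components. -/
def fstDist {V W : Type*} [Norm V] [Sub V] (z w : V × W) : ℝ := ‖z.1 - w.1‖

/-- The distance of the second components. -/
def sndDist {V W : Type*} [Norm W] [Sub W] (z w : V × W) : ℝ := ‖z.2 - w.2‖

lemma fstDist_comm {V W : Type*} [SeminormedAddCommGroup V] (z w : V × W) :
    fstDist z w = fstDist w z :=
  norm_sub_rev _ _

lemma sndDist_comm {V W : Type*} [SeminormedAddCommGroup W] (z w : V × W) :
    sndDist z w = sndDist w z :=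
  norm_sub_rev _ _

lemma kernel_comp_perm (z : Fin 4 → EuclideanSpace ℝ (Fin p) × EuclideanSpace ℝ (Fin q))
    (τ : Equiv.Perm (Fin 4)) : kernel (fun i => z (τ i)) = kernel z := by
  unfold kernel
  congr 1
  exact Equiv.sum_comp (Equiv.mulLeft τ) fun σ : Equiv.Perm (Fin 4) =>
    (‖(z (σ 0)).1 - (z (σ 1)).1‖ * ‖(z (σ 0)).2 - (z (σ 1)).2‖
      - 2 * (‖(z (σ 0)).1 - (z (σ 1)).1‖ * ‖(z (σ 0)).2 - (z (σ 2)).2‖)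
      + ‖(z (σ 0)).1 - (z (σ 1)).1‖ * ‖(z (σ 2)).2 - (z (σ 3)).2‖)

lemma kernel_eq_sum_mixedDiff (z : Fin 4 → EuclideanSpace ℝ (Fin p) × EuclideanSpace ℝ (Fin q)) :
    kernel z = 1 / 96 * ∑ σ : Equiv.Perm (Fin 4),
      mixedDiff fstDist (z (σ 0), z (σ 3)) (z (σ 1), z (σ 2)) *
        mixedDiff sndDist (z (σ 0), z (σ 3)) (z (σ 1), z (σ 2)) := by
  have hmul := sum_perm_four_mixedDiff_mul_mixedDiff (fun i j => fstDist (z i) (z j))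
    (fun i j => sndDist (z i) (z j))
  have hsymm := sum_perm_four_mul_mixedDiff (fun i j => fstDist_comm (z i) (z j))
    (fun i j => sndDist_comm (z i) (z j))
  rw [hsymm] at hmul
  simp only [mixedDiff] at hmul ⊢
  rw [hmul, kernel]
  simp only [fstDist, sndDist]
  ring

lemma integral_kernel {μ : Measure (EuclideanSpace ℝ (Fin p) × EuclideanSpace ℝ (Fin q))}
    [IsProbabilityMeasure μ]
    (hint : Integrable (fun ab => mixedDiff fstDist ab.1 ab.2 * mixedDiff sndDist ab.1 ab.2)
      ((μ.prod μ).prod (μ.prod μ))) :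
    ∫ z, kernel z ∂(Measure.pi fun _ : Fin 4 => μ) =
      (∫ ab, mixedDiff fstDist ab.1 ab.2 * mixedDiff sndDist ab.1 ab.2
        ∂((μ.prod μ).prod (μ.prod μ))) / 4 := by
  have hpres (σ : Equiv.Perm (Fin 4)) := measurePreserving_pi_pair_pair μ (i := σ 0) (j := σ 3)
    (k := σ 1) (l := σ 2) (by simp) (by simp) (by simp) (by simp) (by simp) (by simp)
  have hterm (σ : Equiv.Perm (Fin 4)) :
      ∫ z, mixedDiff fstDist (z (σ 0), z (σ 3)) (z (σ 1), z (σ 2)) *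
        mixedDiff sndDist (z (σ 0), z (σ 3)) (z (σ 1), z (σ 2)) ∂(Measure.pi fun _ => μ) =
      ∫ ab, mixedDiff fstDist ab.1 ab.2 * mixedDiff sndDist ab.1 ab.2
        ∂((μ.prod μ).prod (μ.prod μ)) := by
    rw [← (hpres σ).map_eq] at hint ⊢
    exact (integral_map (hpres σ).aemeasurable hint.aestronglyMeasurable).symm
  simp_rw [kernel_eq_sum_mixedDiff]
  rw [integral_const_mul,
    integral_finsetSum _ fun σ _ => by exact (hpres σ).integrable_comp_of_integrable hint]
  simp only [hterm, Finset.sum_const, Finset.card_univ, Fintype.card_perm, Fintype.card_fin]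
  simp only [Nat.factorial, nsmul_eq_mul]
  push_cast
  ring

theorem dcovSq_lt_top_and_toReal_eq_integral_kernel {Ω : Type*} [MeasurableSpace Ω]
    {P : Measure Ω} [IsProbabilityMeasure P] {X : Ω → EuclideanSpace ℝ (Fin p)}
    {Y : Ω → EuclideanSpace ℝ (Fin q)} (hX : Measurable X) (hY : Measurable Y)
    (hXint : Integrable X P) (hYint : Integrable Y P) :
    dcovSq P X Y < ∞ ∧ (dcovSq P X Y).toReal =
      ∫ z, kernel z ∂(Measure.pi fun _ : Fin 4 => P.map fun ω => (X ω, Y ω)) := by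
  rw [dcovSq_eq_lintegral_bilinCov hX hY]
  have hXY : Measurable fun ω => (X ω, Y ω) := by fun_prop
  set μ := P.map fun ω => (X ω, Y ω)
  have : IsProbabilityMeasure μ := Measure.isProbabilityMeasure_map hXY.aemeasurable
  have hfst : Integrable Prod.fst μ :=
    (integrable_map_measure (by fun_prop) hXY.aemeasurable).2 hXint
  have hsnd : Integrable Prod.snd μ :=
    (integrable_map_measure (by fun_prop) hXY.aemeasurable).2 hYint
  have hd : Integrable (Function.uncurry fstDist) (μ.prod μ) :=
    ((hfst.comp_fst μ).sub (hfst.comp_snd μ)).norm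
  have he : Integrable (Function.uncurry sndDist) (μ.prod μ) :=
    ((hsnd.comp_fst μ).sub (hsnd.comp_snd μ)).norm
  have hf : NegTypeRepresentation (rieszWeight (EuclideanSpace ℝ (Fin p)) 1)
      (fun s z => wave s z.1) fstDist (S := _ × EuclideanSpace ℝ (Fin q)) :=
    negTypeRepresentation_wave_one.comp measurable_fst
  have hg : NegTypeRepresentation (rieszWeight (EuclideanSpace ℝ (Fin q)) 1)
      (fun t z => wave t z.2) sndDist (S := EuclideanSpace ℝ (Fin p) × _) :=
    negTypeRepresentation_wave_one.comp measurable_snd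
  have hfμ (s : EuclideanSpace ℝ (Fin p)) : MemLp (fun z => wave s z.1) 2 μ :=
    MemLp.of_bound (Measurable.aestronglyMeasurable (by fun_prop)) 1
      (ae_of_all _ fun z => (norm_wave _ _).le)
  have hgμ (t : EuclideanSpace ℝ (Fin q)) : MemLp (fun z => wave t z.2) 2 μ :=
    MemLp.of_bound (Measurable.aestronglyMeasurable (by fun_prop)) 1
      (ae_of_all _ fun z => (norm_wave _ _).le)
  rw [hf.lintegral_norm_bilinCov_sq hg hd he hfμ hgμ,
    integral_kernel (hf.integrable_mixedDiff_mul hg hd he)]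
  refine ⟨ENNReal.ofReal_lt_top, ENNReal.toReal_ofReal ?_⟩
  have := hf.integral_mixedDiff_mul_nonneg hg hd he hfμ hgμ
  positivity

end Kernel

section Hoeffding

lemma memLp_two_integral_prod_left {T T' : Type*} [MeasurableSpace T] [MeasurableSpace T']
    {μ : Measure T} {ν : Measure T'} [IsFiniteMeasure μ] [IsProbabilityMeasure ν] {F : T × T' → ℝ}
    (hF : MemLp F 2 (μ.prod ν)) : MemLp (fun x => ∫ y, F (x, y) ∂ν) 2 μ := by
  have hint : Integrable F (μ.prod ν) := hF.integrable one_le_two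
  have hmeas : AEStronglyMeasurable (fun x => ∫ y, F (x, y) ∂ν) μ :=
    hint.integral_prod_left.aestronglyMeasurable
  refine (memLp_two_iff_integrable_sq hmeas).2
    (hF.integrable_sq.integral_prod_left.mono' (hmeas.pow 2) ?_)
  filter_upwards [hint.prod_right_ae, hF.integrable_sq.prod_right_ae] with x hx hx_sq
  rw [Real.norm_of_nonneg (sq_nonneg _)]
  exact even_two.convexOn_pow.map_integral_le (continuous_pow 2).continuousOn isClosed_univ
    (ae_of_all _ fun _ => Set.mem_univ _) hx hx_sq

variable {S : Type*} [MeasurableSpace S] {m : ℕ} (μ : Measure S) (h : (Fin (m + 1) → S) → ℝ)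

/-- The mean of a kernel under independent arguments with law `μ`. -/
noncomputable def kernelMean {k : ℕ} (h : (Fin k → S) → ℝ) : ℝ := ∫ z, h z ∂(Measure.pi fun _ => μ)

/-- The first projection of a kernel: all arguments but the first are averaged out. -/
noncomputable def firstProj (x : S) : ℝ :=
  ∫ w : Fin m → S, h (Fin.cons x w : Fin (m + 1) → S) ∂(Measure.pi fun _ => μ)

/-- The remainder of the first order Hoeffding decomposition of a kernel: the kernel minus its mean
and its centred first projections. -/
noncomputable def hoeffdingRemainder (z : Fin (m + 1) → S) : ℝ :=
  h z - kernelMean μ h - ∑ a, (firstProj μ h (z a) - kernelMean μ h)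

/-- A kernel is degenerate if averaging out all arguments but one always gives zero. -/
def IsDegenerate : Prop :=
  ∀ b : Fin (m + 1), ∀ᵐ x ∂μ, ∫ w, h (b.insertNth x w) ∂(Measure.pi fun _ : Fin m => μ) = 0

variable {μ h}

lemma firstProj_eq_integral_insertNth_zero :
    firstProj μ h =
      fun x => ∫ w, h ((0 : Fin (m + 1)).insertNth x w) ∂(Measure.pi fun _ : Fin m => μ) := by
  ext x
  simp only [firstProj, Fin.insertNth_zero']

lemma integral_insertNth_eq_firstProj
    (hsymm : ∀ z (σ : Equiv.Perm (Fin (m + 1))), h (fun i => z (σ i)) = h z)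
    (b : Fin (m + 1)) (x : S) :
    ∫ w, h (b.insertNth x w) ∂(Measure.pi fun _ : Fin m => μ) = firstProj μ h x := by
  unfold firstProj
  congr 1 with w
  rw [← Fin.cons_comp_cycleRange]
  exact hsymm _ _

lemma hoeffdingRemainder_insertNth (b : Fin (m + 1)) (x : S) (w : Fin m → S) :
    hoeffdingRemainder μ h (b.insertNth x w) =
      h (b.insertNth x w) - firstProj μ h x - ∑ j, (firstProj μ h (w j) - kernelMean μ h) := by
  simp only [hoeffdingRemainder, Fin.sum_univ_succAbove _ b, Fin.insertNth_apply_same,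
    Fin.insertNth_apply_succAbove]
  ring

variable (μ) [IsProbabilityMeasure μ]

lemma measurePreserving_insertNth (b : Fin (m + 1)) :
    MeasurePreserving (fun r : S × (Fin m → S) => (b.insertNth r.1 r.2 : Fin (m + 1) → S))
      (μ.prod (Measure.pi fun _ => μ)) (Measure.pi fun _ => μ) :=
  (measurePreserving_piFinSuccAbove (fun _ : Fin (m + 1) => μ) b).symm

variable {μ}

lemma memLp_firstProj (hh : MemLp h 2 (Measure.pi fun _ => μ)) : MemLp (firstProj μ h) 2 μ := by
  rw [firstProj_eq_integral_insertNth_zero]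
  exact memLp_two_integral_prod_left
    (hh.comp_measurePreserving (measurePreserving_insertNth μ (m := m) 0))

lemma integral_firstProj (hh : Integrable h (Measure.pi fun _ => μ)) :
    ∫ x, firstProj μ h x ∂μ = kernelMean μ h := by
  have hpres := measurePreserving_insertNth μ (m := m) 0
  rw [firstProj_eq_integral_insertNth_zero]
  exact (integral_prod _ (hpres.integrable_comp_of_integrable hh)).symm.trans
    (hpres.hasLaw.integral_comp hh.aestronglyMeasurable)

lemma integral_comp_eval_pi {ι : Type*} [Fintype ι] {f : S → ℝ} (hf : AEStronglyMeasurable f μ)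
    (i : ι) : ∫ w, f (w i) ∂(Measure.pi fun _ => μ) = ∫ x, f x ∂μ :=
  (measurePreserving_eval (fun _ => μ) i).hasLaw.integral_comp hf

lemma memLp_hoeffdingRemainder (hh : MemLp h 2 (Measure.pi fun _ => μ)) :
    MemLp (hoeffdingRemainder μ h) 2 (Measure.pi fun _ => μ) :=
  (hh.sub (memLp_const _)).sub (memLp_finsetSum _ fun a _ =>
    ((memLp_firstProj hh).comp_measurePreserving (measurePreserving_eval (fun _ => μ) a)).sub
      (memLp_const _))

lemma isDegenerate_hoeffdingRemainder
    (hsymm : ∀ z (σ : Equiv.Perm (Fin (m + 1))), h (fun i => z (σ i)) = h z)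
    (hh : MemLp h 2 (Measure.pi fun _ => μ)) : IsDegenerate μ (hoeffdingRemainder μ h) := by
  intro b
  have hh₁ := hh.integrable one_le_two
  filter_upwards [((measurePreserving_insertNth μ b).integrable_comp_of_integrable
    hh₁).prod_right_ae] with x (hx : Integrable (fun w => h (b.insertNth x w)) _)
  have hproj := (memLp_firstProj hh).integrable one_le_two
  have hcentred : Integrable (fun x => firstProj μ h x - kernelMean μ h) μ :=
    hproj.sub (integrable_const _)
  have hcoord (j : Fin m) : Integrable (fun w : Fin m → S => firstProj μ h (w j) - kernelMean μ h)
      (Measure.pi fun _ => μ) :=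
    (measurePreserving_eval (fun _ => μ) j).integrable_comp_of_integrable hcentred
  have hzero (j : Fin m) : ∫ w : Fin m → S, (firstProj μ h (w j) - kernelMean μ h)
      ∂(Measure.pi fun _ => μ) = 0 := by
    rw [integral_comp_eval_pi hcentred.aestronglyMeasurable j,
      integral_sub hproj (integrable_const _), integral_firstProj hh₁, integral_const,
      probReal_univ, one_smul, sub_self]
  simp_rw [hoeffdingRemainder_insertNth]
  rw [integral_sub (hx.sub' (integrable_const _)) (integrable_finsetSum _ fun j _ => hcoord j),
    integral_sub hx (integrable_const _), integral_insertNth_eq_firstProj hsymm,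
    integral_finsetSum _ fun j _ => hcoord j, Finset.sum_eq_zero fun j _ => hzero j,
    integral_const, probReal_univ, one_smul, sub_self, sub_zero]

end Hoeffding

section StrictMono

variable {n k : ℕ}

open scoped Classical in
lemma sum_strictMono_image {M : Type*} [AddCommMonoid M] (F : Finset (Fin n) → M) :
    ∑ τ ∈ Finset.univ.filter (fun τ : Fin k → Fin n => StrictMono τ), F (Finset.univ.image τ) =
      ∑ s ∈ Finset.powersetCard k Finset.univ, F s := by
  refine Finset.sum_nbij (fun τ => Finset.univ.image τ) ?_ ?_ ?_ fun _ _ => rfl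
  · intro τ hτ
    have hτ : StrictMono τ := (Finset.mem_filter.1 hτ).2
    simp [Finset.mem_powersetCard, Finset.card_image_of_injective _ hτ.injective]
  · intro τ hτ τ' hτ' himage
    have hτ : StrictMono τ := by simpa using hτ
    have hτ' : StrictMono τ' := by simpa using hτ'
    refine (hτ.range_inj hτ').1 ?_
    simpa using congrArg (fun s : Finset (Fin n) => (s : Set (Fin n))) himage
  · intro s hs
    have hs : s.card = k := by simpa [Finset.mem_powersetCard] using hs
    refine ⟨s.orderEmbOfFin hs, by simpa using (s.orderEmbOfFin hs).strictMono, ?_⟩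
    apply Finset.coe_injective
    simp

open scoped Classical in
lemma card_strictMono (n k : ℕ) :
    (Finset.univ.filter (fun τ : Fin k → Fin n => StrictMono τ)).card = n.choose k := by
  rw [Finset.card_eq_sum_ones, sum_strictMono_image fun _ => 1, ← Finset.card_eq_sum_ones,
    Finset.card_powersetCard, Finset.card_fin]

lemma card_powersetCard_succ_filter_mem {ι : Type*} [Fintype ι] [DecidableEq ι] (i : ι) :
    ((Finset.powersetCard (k + 1) Finset.univ).filter (fun s => i ∈ s)).card =
      (Fintype.card ι - 1).choose k := by
  simpa using Finset.card_filter_powersetCard_subset {i} (Finset.univ : Finset ι) (k + 1)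
    (Finset.subset_univ _) (by simp)

open scoped Classical in
lemma sum_strictMono_sum {M : Type*} [AddCommMonoid M] (f : Fin n → M) :
    ∑ τ ∈ Finset.univ.filter (fun τ : Fin (k + 1) → Fin n => StrictMono τ), ∑ a, f (τ a) =
      (n - 1).choose k • ∑ i, f i := by
  have hsum_image : ∀ τ ∈ Finset.univ.filter (fun τ : Fin (k + 1) → Fin n => StrictMono τ),
      ∑ a, f (τ a) = ∑ i ∈ Finset.univ.image τ, f i := fun τ hτ =>
    (Finset.sum_image (Finset.mem_filter.1 hτ).2.injective.injOn).symm
  rw [Finset.sum_congr rfl hsum_image, sum_strictMono_image fun s => ∑ i ∈ s, f i,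
    Finset.sum_comm' (t' := Finset.univ)
      (s' := fun i => (Finset.powersetCard (k + 1) Finset.univ).filter (i ∈ ·)) (by simp),
    Finset.smul_sum]
  simp only [Finset.sum_const, card_powersetCard_succ_filter_mem, Fintype.card_fin]

end StrictMono

section Overlap

variable {ι κ : Type*}

/-- Two index tuples overlap twice if no single position of the second one accounts for all the
indices it shares with the first one; for an injective second tuple this says that at least two
indices are shared. -/
def OverlapTwice (τ τ' : κ → ι) : Prop := ∀ b, ∃ a ≠ b, τ' a ∈ Set.range τ

variable [Fintype ι] [Fintype κ] [DecidableEq κ]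

open scoped Classical in
lemma card_two_values_eq_mul_sq_le {a b : κ} (hab : a ≠ b) (x y : ι) :
    (Finset.univ.filter (fun τ : κ → ι => τ a = x ∧ τ b = y)).card * Fintype.card ι ^ 2 ≤
      Fintype.card ι ^ Fintype.card κ := by
  have hinj : Set.InjOn
      (fun r : (κ → ι) × ι × ι => Function.update (Function.update r.1 a r.2.1) b r.2.2)
      ↑(Finset.univ.filter (fun τ : κ → ι => τ a = x ∧ τ b = y) ×ˢ
        (Finset.univ : Finset (ι × ι))) := by
    rintro ⟨τ, u, v⟩ hτ ⟨τ', u', v'⟩ hτ' hupdate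
    have hupdate := congrFun hupdate
    have hu : u = u' := by simpa [hab] using hupdate a
    have hv : v = v' := by simpa using hupdate b
    have hτ : τ a = x ∧ τ b = y := by simpa using hτ
    have hτ' : τ' a = x ∧ τ' b = y := by simpa using hτ'
    have hττ' : τ = τ' := by
      ext c
      by_cases ha : c = a
      · rw [ha, hτ.1, hτ'.1]
      by_cases hb : c = b
      · rw [hb, hτ.2, hτ'.2]
      simpa [ha, hb] using hupdate c
    rw [hu, hv, hττ']
  have hcard := Finset.card_le_card_of_injOn (t := Finset.univ) _ (fun _ _ => Finset.mem_univ _)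
    hinj
  simpa [Finset.card_product, sq] using hcard

open scoped Classical in
lemma card_overlapTwice_mul_sq_le [Nonempty κ] (τ : κ → ι) :
    (Finset.univ.filter (OverlapTwice τ)).card * Fintype.card ι ^ 2 ≤
      Fintype.card κ ^ 4 * Fintype.card ι ^ Fintype.card κ := by
  let positions : Finset ((κ × κ) × κ × κ) := Finset.univ.filter fun r => r.1.1 ≠ r.1.2
  let fibre (r : (κ × κ) × κ × κ) : Finset (κ → ι) :=
    Finset.univ.filter fun τ' => τ' r.1.1 = τ r.2.1 ∧ τ' r.1.2 = τ r.2.2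
  have hsub : Finset.univ.filter (OverlapTwice τ) ⊆ positions.biUnion fibre := by
    intro τ' hτ'
    have hτ' : OverlapTwice τ τ' := (Finset.mem_filter.1 hτ').2
    obtain ⟨a, -, c, hc⟩ := hτ' (Classical.arbitrary κ)
    obtain ⟨b, hb, d, hd⟩ := hτ' a
    exact Finset.mem_biUnion.2
      ⟨((a, b), c, d), by simpa [positions] using hb.symm, by simp [fibre, hc, hd]⟩
  calc (Finset.univ.filter (OverlapTwice τ)).card * Fintype.card ι ^ 2
    _ ≤ (∑ r ∈ positions, (fibre r).card) * Fintype.card ι ^ 2 := by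
        gcongr
        exact (Finset.card_le_card hsub).trans Finset.card_biUnion_le
    _ ≤ positions.card * Fintype.card ι ^ Fintype.card κ := by
        rw [Finset.sum_mul, ← smul_eq_mul]
        exact Finset.sum_le_card_nsmul _ _ _ fun r hr =>
          card_two_values_eq_mul_sq_le (Finset.mem_filter.1 hr).2 _ _
    _ ≤ Fintype.card κ ^ 4 * Fintype.card ι ^ Fintype.card κ := by
        gcongr
        refine (Finset.card_le_univ positions).trans_eq ?_
        simp only [Fintype.card_prod]
        ring

end Overlap

lemma tendsto_pow_div_choose (k : ℕ) :
    Tendsto (fun n : ℕ => (n : ℝ) ^ k / n.choose k) atTop (𝓝 (k.factorial : ℝ)) := by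
  have hequiv := (Asymptotics.IsEquivalent.refl (u := fun n : ℕ => (n : ℝ) ^ k) (l := atTop)).div
    (isEquivalent_choose k)
  refine hequiv.symm.tendsto_nhds (tendsto_const_nhds.congr' ?_)
  filter_upwards [eventually_gt_atTop 0] with n hn
  simp only [Pi.div_apply]
  field_simp

section SecondMoment

variable {Ω : Type*} [MeasurableSpace Ω] {P : Measure Ω}

lemma integral_mul_le_of_integral_sq_le {f g : Ω → ℝ} {M : ℝ} (hf : MemLp f 2 P)
    (hg : MemLp g 2 P) (hfM : ∫ ω, f ω ^ 2 ∂P ≤ M) (hgM : ∫ ω, g ω ^ 2 ∂P ≤ M) :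
    ∫ ω, f ω * g ω ∂P ≤ M := by
  calc ∫ ω, f ω * g ω ∂P
    _ ≤ ∫ ω, (f ω ^ 2 + g ω ^ 2) / 2 ∂P := by
        refine integral_mono (hf.integrable_mul hg)
          ((hf.integrable_sq.add hg.integrable_sq).div_const 2) fun ω => ?_
        linarith [two_mul_le_add_sq (f ω) (g ω)]
    _ = (∫ ω, f ω ^ 2 ∂P + ∫ ω, g ω ^ 2 ∂P) / 2 := by
        rw [integral_div, integral_add hf.integrable_sq hg.integrable_sq]
    _ ≤ M := by linarith

lemma integral_sum_sq_le {ι : Type*} {T : Finset ι} {G : ι → Ω → ℝ} {r : ι → ι → Prop}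
    [∀ i, DecidablePred (r i)] {K M : ℝ} (hG : ∀ i ∈ T, MemLp (G i) 2 P)
    (hM : ∀ i ∈ T, ∫ ω, G i ω ^ 2 ∂P ≤ M)
    (hr : ∀ i ∈ T, ∀ j ∈ T, ¬ r i j → ∫ ω, G i ω * G j ω ∂P = 0)
    (hK : ∀ i ∈ T, ((T.filter (r i)).card : ℝ) ≤ K) :
    ∫ ω, (∑ i ∈ T, G i ω) ^ 2 ∂P ≤ T.card * (K * M) := by
  have hint : ∀ i ∈ T, ∀ j ∈ T, Integrable (fun ω => G i ω * G j ω) P :=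
    fun i hi j hj => (hG i hi).integrable_mul (hG j hj)
  have hrow (i : ι) (hi : i ∈ T) : ∑ j ∈ T, ∫ ω, G i ω * G j ω ∂P ≤ K * M := by
    have hM₀ : 0 ≤ M := (integral_nonneg fun ω => sq_nonneg _).trans (hM i hi)
    calc ∑ j ∈ T, ∫ ω, G i ω * G j ω ∂P
      _ ≤ ∑ j ∈ T, if r i j then M else 0 := by
          refine Finset.sum_le_sum fun j hj => ?_
          split_ifs with hij
          · exact integral_mul_le_of_integral_sq_le (hG i hi) (hG j hj) (hM i hi) (hM j hj)
          · exact (hr i hi j hj hij).le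
      _ = (T.filter (r i)).card * M := by
          rw [← Finset.sum_filter, Finset.sum_const, nsmul_eq_mul]
      _ ≤ K * M := by gcongr; exact hK i hi
  calc ∫ ω, (∑ i ∈ T, G i ω) ^ 2 ∂P
    _ = ∑ i ∈ T, ∑ j ∈ T, ∫ ω, G i ω * G j ω ∂P := by
        simp_rw [sq, Finset.sum_mul_sum]
        rw [integral_finsetSum _ fun i hi => integrable_finsetSum _ (hint i hi)]
        exact Finset.sum_congr rfl fun i hi => integral_finsetSum _ (hint i hi)
    _ ≤ T.card * (K * M) := by
        rw [← nsmul_eq_mul]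
        exact Finset.sum_le_card_nsmul _ _ _ hrow

lemma tendstoInMeasure_zero_of_tendsto_integral_sq {f : ℕ → Ω → ℝ} (hf : ∀ n, MemLp (f n) 2 P)
    (hlim : Tendsto (fun n => ∫ ω, f n ω ^ 2 ∂P) atTop (𝓝 0)) :
    TendstoInMeasure P f atTop 0 := by
  have heLpNorm (n : ℕ) :
      eLpNorm (f n) 2 P = ENNReal.ofReal ((∫ ω, f n ω ^ 2 ∂P) ^ (2 : ℝ)⁻¹) := by
    rw [(hf n).eLpNorm_eq_integral_rpow_norm (by simp) (by simp)]
    simp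
  have hroot : Tendsto (fun n => (∫ ω, f n ω ^ 2 ∂P) ^ (2 : ℝ)⁻¹) atTop (𝓝 0) := by
    simpa using hlim.rpow_const (p := (2 : ℝ)⁻¹) (Or.inr (by norm_num))
  refine tendstoInMeasure_of_tendsto_eLpNorm two_ne_zero (fun n => (hf n).aestronglyMeasurable)
    aestronglyMeasurable_zero ?_
  simpa only [sub_zero, heLpNorm, ENNReal.ofReal_zero] using ENNReal.tendsto_ofReal hroot

end SecondMoment

section Sample

variable {Ω S ι : Type*} [MeasurableSpace Ω] [MeasurableSpace S] {P : Measure Ω} {Z : ι → Ω → S}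

lemma indepFun_comp_of_disjoint_range (hindep : iIndepFun Z P) (hZ : ∀ i, AEMeasurable (Z i) P)
    {α β : Type*} [Finite α] [Finite β] {τ : α → ι} {τ' : β → ι}
    (hdisj : Disjoint (Set.range τ) (Set.range τ')) :
    IndepFun (fun ω a => Z (τ a) ω) (fun ω b => Z (τ' b) ω) P := by
  have hrange := hindep.indepFun_finset₀ (Set.finite_range τ).toFinset
    (Set.finite_range τ').toFinset (by simpa using hdisj) hZ
  exact hrange.comp
    (φ := fun (v : (Set.finite_range τ).toFinset → S) a => v ⟨τ a, by simp⟩)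
    (ψ := fun (v : (Set.finite_range τ').toFinset → S) b => v ⟨τ' b, by simp⟩)
    (by fun_prop) (by fun_prop)

lemma hasLaw_comp_sample {μ : Measure S} (hindep : iIndepFun Z P)
    (hZ : ∀ i, HasLaw (Z i) μ P) {κ : Type*} [Fintype κ] {τ : κ → ι} (hτ : Function.Injective τ) :
    HasLaw (fun ω a => Z (τ a) ω) (Measure.pi fun _ => μ) P :=
  iIndepFun.hasLaw_pi (fun a => hZ (τ a)) (hindep.precomp hτ)

lemma memLp_comp_sample {μ : Measure S} (hindep : iIndepFun Z P)
    (hZ : ∀ i, HasLaw (Z i) μ P) {κ : Type*} [Fintype κ] {τ : κ → ι} (hτ : Function.Injective τ)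
    {g : (κ → S) → ℝ} {p : ℝ≥0∞}
    (hg : MemLp g p (Measure.pi fun _ => μ)) : MemLp (fun ω => g fun a => Z (τ a) ω) p P := by
  have hlaw := hasLaw_comp_sample hindep hZ hτ
  rw [← hlaw.map_eq] at hg
  exact hg.comp_of_map hlaw.aemeasurable

lemma integral_comp_sample {μ : Measure S} (hindep : iIndepFun Z P)
    (hZ : ∀ i, HasLaw (Z i) μ P) {κ : Type*} [Fintype κ] {τ : κ → ι} (hτ : Function.Injective τ)
    {g : (κ → S) → ℝ}
    (hg : AEStronglyMeasurable g (Measure.pi fun _ => μ)) :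
    ∫ ω, g (fun a => Z (τ a) ω) ∂P = ∫ z, g z ∂(Measure.pi fun _ => μ) :=
  (hasLaw_comp_sample hindep hZ hτ).integral_comp hg

variable {μ : Measure S} [IsProbabilityMeasure μ] {m : ℕ} {g : (Fin (m + 1) → S) → ℝ}

lemma integral_mul_insertNth_eq_zero {T : Type*} [MeasurableSpace T] {ν : Measure (T × S)}
    [SFinite ν] (hν : MeasurePreserving Prod.snd ν μ) (hdeg : IsDegenerate μ g) (F : T → ℝ)
    (b : Fin (m + 1)) :
    ∫ r, F r.1.1 * g (b.insertNth r.1.2 r.2) ∂(ν.prod (Measure.pi fun _ : Fin m => μ)) = 0 := by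
  by_cases hint : Integrable (fun r : (T × S) × (Fin m → S) =>
    F r.1.1 * g (b.insertNth r.1.2 r.2)) (ν.prod (Measure.pi fun _ => μ))
  · rw [integral_prod _ hint]
    refine integral_eq_zero_of_ae ?_
    filter_upwards [hν.quasiMeasurePreserving.ae (hdeg b)] with u hu
    simp only [integral_const_mul, hu, mul_zero, Pi.zero_apply]
  · exact integral_undef hint

lemma integral_mul_comp_insertNth_eq_zero {T : Type*} [MeasurableSpace T] {ρ : Measure T}
    [IsFiniteMeasure P] {V : Ω → T} {X : Ω → S} {W : Ω → Fin m → S} (hV : HasLaw V ρ P)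
    (hX : HasLaw X μ P) (hW : HasLaw W (Measure.pi fun _ => μ) P)
    (hindep : IndepFun (fun ω => (V ω, X ω)) W P) {F : T → ℝ} (hF : AEStronglyMeasurable F ρ)
    (hg : AEStronglyMeasurable g (Measure.pi fun _ => μ)) (hdeg : IsDegenerate μ g)
    (b : Fin (m + 1)) :
    ∫ ω, F (V ω) * g (b.insertNth (X ω) (W ω)) ∂P = 0 := by
  set ν : Measure (T × S) := P.map fun ω => (V ω, X ω)
  have hVX : HasLaw (fun ω => (V ω, X ω)) ν P := ⟨hV.aemeasurable.prodMk hX.aemeasurable, rfl⟩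
  have hfst : MeasurePreserving Prod.fst ν ρ :=
    (HasLaw.comp_of_hasLaw_comp measurable_fst.aemeasurable hVX .id hV).measurePreserving
      measurable_fst
  have hsnd : MeasurePreserving Prod.snd ν μ :=
    (HasLaw.comp_of_hasLaw_comp measurable_snd.aemeasurable hVX .id hX).measurePreserving
      measurable_snd
  have hinsert : MeasurePreserving
      (fun r : (T × S) × (Fin m → S) => (b.insertNth r.1.2 r.2 : Fin (m + 1) → S))
      (ν.prod (Measure.pi fun _ => μ)) (Measure.pi fun _ => μ) :=
    (measurePreserving_insertNth μ b).comp (hsnd.prod (MeasurePreserving.id _))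
  have hmeas : AEStronglyMeasurable
      (fun r : (T × S) × (Fin m → S) => F r.1.1 * g (b.insertNth r.1.2 r.2))
      (ν.prod (Measure.pi fun _ => μ)) :=
    (hF.comp_measurePreserving (hfst.comp measurePreserving_fst)).mul
      (hg.comp_measurePreserving hinsert)
  exact ((hindep.hasLaw_prod hVX hW).integral_comp hmeas).trans
    (integral_mul_insertNth_eq_zero hsnd hdeg F b)

lemma integral_mul_comp_sample_eq_zero (hindep : iIndepFun Z P) (hZ : ∀ i, HasLaw (Z i) μ P)
    (hg : AEStronglyMeasurable g (Measure.pi fun _ => μ)) (hdeg : IsDegenerate μ g)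
    {κ : Type*} [Fintype κ] {F : (κ → S) → ℝ} (hF : AEStronglyMeasurable F (Measure.pi fun _ => μ))
    {τ : κ → ι} (hτ : Function.Injective τ) {τ' : Fin (m + 1) → ι} (hτ' : Function.Injective τ')
    {b : Fin (m + 1)} (hb : ∀ a ≠ b, τ' a ∉ Set.range τ) :
    ∫ ω, F (fun a => Z (τ a) ω) * g (fun a => Z (τ' a) ω) ∂P = 0 := by
  have : IsProbabilityMeasure P := (hZ (τ' b)).isProbabilityMeasure
  have hdisj : Disjoint (Set.range fun o : Option κ => o.elim (τ' b) τ)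
      (Set.range fun j => τ' (b.succAbove j)) := by
    rw [Set.disjoint_right]
    rintro _ ⟨j, rfl⟩ ⟨_ | a, ha⟩
    · exact Fin.succAbove_ne b j (hτ' ha).symm
    · exact hb _ (Fin.succAbove_ne b j) ⟨a, ha⟩
  have hindep_rest : IndepFun (fun ω => (fun a => Z (τ a) ω, Z (τ' b) ω))
      (fun ω j => Z (τ' (b.succAbove j)) ω) P :=
    (indepFun_comp_of_disjoint_range hindep (fun i => (hZ i).aemeasurable) hdisj).comp
      (φ := fun v => (fun a => v (some a), v none)) (ψ := id) (by fun_prop) measurable_id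
  have hsplit (ω : Ω) : (fun a => Z (τ' a) ω) =
      b.insertNth (Z (τ' b) ω) (fun j => Z (τ' (b.succAbove j)) ω) :=
    (Fin.insertNth_self_removeNth b fun a => Z (τ' a) ω).symm
  simp_rw [hsplit]
  exact integral_mul_comp_insertNth_eq_zero (hasLaw_comp_sample hindep hZ hτ) (hZ (τ' b))
    (hasLaw_comp_sample hindep hZ (hτ'.comp Fin.succAbove_right_injective)) hindep_rest hF hg hdeg b

end Sample

section UStatistic

open Classical in
/-- The U-statistic with kernel `h` of order `k` of a sample of size `n`: the average of `h` over
all strictly increasing index tuples. It is `0` if `n < k`. -/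
noncomputable def uStatistic {S : Type*} {k : ℕ} (h : (Fin k → S) → ℝ) (n : ℕ) (z : Fin n → S) :
    ℝ :=
  ((n.choose k : ℕ) : ℝ)⁻¹ *
    ∑ τ ∈ Finset.univ.filter (fun τ : Fin k → Fin n => StrictMono τ), h (fun a => z (τ a))

variable {S : Type*} [MeasurableSpace S] {μ : Measure S} {m n : ℕ}

lemma uStatistic_sub_kernelMean (h : (Fin (m + 1) → S) → ℝ) (hn : m + 1 ≤ n) (z : Fin n → S) :
    uStatistic h n z - kernelMean μ h = uStatistic (hoeffdingRemainder μ h) n z +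
      (m + 1) * (n : ℝ)⁻¹ * ∑ i, (firstProj μ h (z i) - kernelMean μ h) := by
  obtain ⟨n, rfl⟩ : ∃ n', n = n' + 1 := ⟨n - 1, by omega⟩
  have hchoose_pos : (((n + 1).choose (m + 1) : ℕ) : ℝ) ≠ 0 := by
    exact_mod_cast (Nat.choose_pos hn).ne'
  have hchoose : ((n : ℝ) + 1) * n.choose m = (n + 1).choose (m + 1) * (m + 1) := by
    exact_mod_cast Nat.add_one_mul_choose_eq n m
  have hlinear := sum_strictMono_sum (k := m) fun i => firstProj μ h (z i) - kernelMean μ h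
  simp only [uStatistic, hoeffdingRemainder, Finset.sum_sub_distrib (f := fun _ => h _ - _),
    hlinear, nsmul_eq_mul, Nat.add_sub_cancel]
  rw [Finset.sum_sub_distrib, Finset.sum_const, card_strictMono, nsmul_eq_mul]
  push_cast
  field_simp
  linear_combination (∑ i, (firstProj μ h (z i) - kernelMean μ h)) * hchoose

lemma sqrt_mul_uStatistic_sub_kernelMean (h : (Fin (m + 1) → S) → ℝ) (hn : m + 1 ≤ n)
    (z : ℕ → S) :
    √n * (uStatistic h n (fun i => z i) - kernelMean μ h) =
      √n * uStatistic (hoeffdingRemainder μ h) n (fun i => z i) +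
        (√n)⁻¹ * (∑ i ∈ Finset.range n, (m + 1) * firstProj μ h (z i) -
          n * ((m + 1) * kernelMean μ h)) := by
  have hinv : √n * (n : ℝ)⁻¹ = (√n)⁻¹ := by
    rw [← div_eq_mul_inv, Real.sqrt_div_self]
  rw [uStatistic_sub_kernelMean h hn, Fin.sum_univ_eq_sum_range
    (fun i => firstProj μ h (z i) - kernelMean μ h), Finset.sum_sub_distrib, Finset.sum_const,
    Finset.card_range, nsmul_eq_mul, ← Finset.mul_sum, ← hinv]
  ring

variable {Ω : Type*} [MeasurableSpace Ω] {P : Measure Ω} {Z : ℕ → Ω → S}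

lemma memLp_uStatistic (hindep : iIndepFun Z P) (hZ : ∀ i, HasLaw (Z i) μ P) {k : ℕ}
    {g : (Fin k → S) → ℝ} {p : ℝ≥0∞} (hg : MemLp g p (Measure.pi fun _ => μ)) (n : ℕ) :
    MemLp (fun ω => uStatistic g n fun i => Z i ω) p P :=
  (memLp_finsetSum _ fun _ hτ => memLp_comp_sample hindep hZ
    (Fin.val_injective.comp (Finset.mem_filter.1 hτ).2.injective) hg).const_mul _

variable [IsProbabilityMeasure μ]

lemma integral_uStatistic_sq_le (hindep : iIndepFun Z P) (hZ : ∀ i, HasLaw (Z i) μ P)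
    {g : (Fin (m + 1) → S) → ℝ} (hg : MemLp g 2 (Measure.pi fun _ => μ))
    (hdeg : IsDegenerate μ g) (hn : m + 1 ≤ n) :
    ∫ ω, (uStatistic g n fun i => Z i ω) ^ 2 ∂P ≤
      (n.choose (m + 1) : ℝ)⁻¹ * ((m + 1) ^ 4 * n ^ (m + 1) / n ^ 2 *
        ∫ z, g z ^ 2 ∂(Measure.pi fun _ => μ)) := by
  classical
  set T := Finset.univ.filter (fun τ : Fin (m + 1) → Fin n => StrictMono τ)
  have hinj (τ) (hτ : τ ∈ T) : Function.Injective fun a => (τ a : ℕ) :=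
    Fin.val_injective.comp (Finset.mem_filter.1 hτ).2.injective
  have hsum : ∫ ω, (∑ τ ∈ T, g fun a => Z (τ a) ω) ^ 2 ∂P ≤ T.card *
      ((m + 1) ^ 4 * n ^ (m + 1) / n ^ 2 * ∫ z, g z ^ 2 ∂(Measure.pi fun _ => μ)) := by
    refine integral_sum_sq_le (r := OverlapTwice)
      (fun τ hτ => memLp_comp_sample hindep hZ (hinj τ hτ) hg)
      (fun τ hτ => (integral_comp_sample hindep hZ (hinj τ hτ)
        (hg.aestronglyMeasurable.pow 2)).le) ?_ ?_
    · intro τ hτ τ' hτ' hoverlap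
      obtain ⟨b, hb⟩ : ∃ b, ∀ a ≠ b, τ' a ∉ Set.range τ := by
        simpa only [OverlapTwice, not_forall, not_exists, not_and] using hoverlap
      refine integral_mul_comp_sample_eq_zero hindep hZ hg.aestronglyMeasurable hdeg
        hg.aestronglyMeasurable (hinj τ hτ) (hinj τ' hτ') (b := b) ?_
      rintro a hab ⟨c, hc⟩
      exact hb a hab ⟨c, Fin.val_injective hc⟩
    · intro τ _
      have hn₀ : (0 : ℝ) < n := by exact_mod_cast (Nat.succ_pos m).trans_le hn
      rw [le_div_iff₀ (by positivity)]
      have hcard : (T.filter (OverlapTwice τ)).card * n ^ 2 ≤ (m + 1) ^ 4 * n ^ (m + 1) := by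
        refine (Nat.mul_le_mul_right _ (Finset.card_le_card
          (Finset.filter_subset_filter _ (Finset.subset_univ T)))).trans ?_
        simpa using card_overlapTwice_mul_sq_le τ
      exact_mod_cast hcard
  have hchoose : (0 : ℝ) < n.choose (m + 1) := by exact_mod_cast Nat.choose_pos hn
  rw [card_strictMono] at hsum
  simp_rw [uStatistic, mul_pow]
  rw [integral_const_mul]
  refine (mul_le_mul_of_nonneg_left hsum (by positivity)).trans_eq ?_
  field_simp

lemma tendstoInMeasure_sqrt_mul_uStatistic (hindep : iIndepFun Z P) (hZ : ∀ i, HasLaw (Z i) μ P)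
    {g : (Fin (m + 1) → S) → ℝ} (hg : MemLp g 2 (Measure.pi fun _ => μ))
    (hdeg : IsDegenerate μ g) :
    TendstoInMeasure P (fun (n : ℕ) ω => √n * uStatistic g n fun i => Z i ω) atTop 0 := by
  refine tendstoInMeasure_zero_of_tendsto_integral_sq
    (fun n => (memLp_uStatistic hindep hZ hg n).const_mul _) ?_
  set M := ∫ z, g z ^ 2 ∂(Measure.pi fun _ => μ) with hM
  have hlim : Tendsto (fun n : ℕ => (m + 1) ^ 4 * M *
      ((n : ℝ) ^ (m + 1) / n.choose (m + 1) * (n : ℝ)⁻¹)) atTop (𝓝 0) := by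
    simpa using ((tendsto_pow_div_choose (m + 1)).mul
      (tendsto_inv_atTop_nhds_zero_nat (𝕜 := ℝ))).const_mul ((m + 1) ^ 4 * M)
  refine squeeze_zero' (Eventually.of_forall fun n => integral_nonneg fun ω => sq_nonneg _) ?_ hlim
  filter_upwards [eventually_ge_atTop (m + 1)] with n hn
  have hn₀ : (n : ℝ) ≠ 0 := by exact_mod_cast ((Nat.succ_pos m).trans_le hn).ne'
  simp_rw [mul_pow, Real.sq_sqrt (Nat.cast_nonneg n)]
  rw [integral_const_mul]
  refine (mul_le_mul_of_nonneg_left (integral_uStatistic_sq_le hindep hZ hg hdeg hn)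
    (Nat.cast_nonneg n)).trans_eq ?_
  rw [← hM]
  field_simp

theorem tendstoInDistribution_uStatistic [IsProbabilityMeasure P] (hindep : iIndepFun Z P)
    (hZ : ∀ i, HasLaw (Z i) μ P) {h : (Fin (m + 1) → S) → ℝ}
    (hsymm : ∀ z (σ : Equiv.Perm (Fin (m + 1))), h (fun i => z (σ i)) = h z)
    (hh : MemLp h 2 (Measure.pi fun _ => μ)) {Ω' : Type*} [MeasurableSpace Ω'] {Q : Measure Ω'}
    [IsProbabilityMeasure Q] {N : Ω' → ℝ}
    (hN : HasLaw N (gaussianReal 0 ((m + 1) ^ 2 * Var[firstProj μ h; μ]).toNNReal) Q) :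
    TendstoInDistribution
      (fun (n : ℕ) ω => √n * (uStatistic h n (fun i => Z i ω) - kernelMean μ h))
      atTop N (fun _ => P) Q := by
  have hproj := memLp_firstProj hh
  set f : S → ℝ := fun x => (m + 1) * firstProj μ h x
  have hf : MemLp f 2 μ := hproj.const_mul _
  have hfZ (i : ℕ) : IdentDistrib (f ∘ Z i) f P μ :=
    ((hZ i).identDistrib .id).comp_of_aemeasurable
      (by simpa only [(hZ i).map_eq] using hf.aestronglyMeasurable.aemeasurable)
  have hvar : Var[f ∘ Z 0; P] = (m + 1) ^ 2 * Var[firstProj μ h; μ] := by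
    rw [(hfZ 0).variance_eq, variance_const_mul]
  have hmean : ∫ ω, (f ∘ Z 0) ω ∂P = (m + 1) * kernelMean μ h := by
    rw [(hfZ 0).integral_eq, integral_const_mul, integral_firstProj (hh.integrable one_le_two)]
  have hindep_f : iIndepFun (fun i => f ∘ Z i) P :=
    hindep.comp₀ (fun _ => f) (fun i => (hZ i).aemeasurable) fun i => by
      simpa only [(hZ i).map_eq] using hf.aestronglyMeasurable.aemeasurable
  have hlinear := tendstoInDistribution_inv_sqrt_mul_sum_sub (by rwa [hvar])
    ((hfZ 0).symm.memLp_snd hf) hindep_f fun i => (hfZ i).trans (hfZ 0).symm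
  rw [hmean] at hlinear
  have hremainder := tendstoInMeasure_sqrt_mul_uStatistic hindep hZ (memLp_hoeffdingRemainder hh)
    (isDegenerate_hoeffdingRemainder hsymm hh)
  refine tendstoInDistribution_of_tendstoInMeasure_sub _ N hlinear
    (hremainder.congr' ?_ (ae_eq_refl _)) fun n =>
    (((memLp_uStatistic hindep hZ hh n).sub
      (memLp_const _)).const_mul _).aestronglyMeasurable.aemeasurable
  filter_upwards [eventually_ge_atTop (m + 1)] with n hn
  refine ae_of_all _ fun ω => ?_
  simp only [Pi.sub_apply, sqrt_mul_uStatistic_sub_kernelMean h hn fun i => Z i ω, f,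
    Function.comp_apply, add_sub_cancel_right]

end UStatistic

end DistCov

theorem mainTheorem5 {p q : ℕ}
    {Ω : Type*} [MeasurableSpace Ω] (P : Measure Ω) [IsProbabilityMeasure P]
    (X : Ω → EuclideanSpace ℝ (Fin p)) (Y : Ω → EuclideanSpace ℝ (Fin q))
    (hX : Measurable X) (hY : Measurable Y)
    -- finite first moments
    (hX1 : Integrable X P) (hY1 : Integrable Y P)
    -- the kernel has a finite second moment under four independent copies of `(X, Y)`
    (hker : MemLp (DistCov.kernel (p := p) (q := q)) 2
      (Measure.pi fun _ : Fin 4 => P.map (fun ω => (X ω, Y ω))))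
    -- `0 < Var(h₁(X,Y)) < ∞`
    (hvar_pos : 0 < evariance
      (fun ω => DistCov.kernelProj (P.map (fun ω => (X ω, Y ω))) (X ω, Y ω)) P)
    (hvar_fin : evariance
      (fun ω => DistCov.kernelProj (P.map (fun ω => (X ω, Y ω))) (X ω, Y ω)) P < ∞)
    -- a random sample from `(X, Y)`
    {Ω' : Type*} [MeasurableSpace Ω'] (P' : Measure Ω') [IsProbabilityMeasure P']
    (Xs : ℕ → Ω' → EuclideanSpace ℝ (Fin p)) (Ys : ℕ → Ω' → EuclideanSpace ℝ (Fin q))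
    (hindep : iIndepFun (fun i ω => (Xs i ω, Ys i ω)) P')
    (hident : ∀ i, IdentDistrib (fun ω => (Xs i ω, Ys i ω)) (fun ω => (X ω, Y ω)) P' P)
    -- a centred normal variable with variance `16 Var(h₁(X,Y))`
    {Ω'' : Type*} [MeasurableSpace Ω''] (Q : Measure Ω'') [IsProbabilityMeasure Q]
    (Z : Ω'' → ℝ)
    (hZ : HasLaw Z (gaussianReal 0 (16 * variance
      (fun ω => DistCov.kernelProj (P.map (fun ω => (X ω, Y ω))) (X ω, Y ω)) P).toNNReal) Q) :
    DistCov.dcovSq P X Y < ∞ ∧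
    TendstoInDistribution
      (fun (n : ℕ) (ω : Ω') => Real.sqrt n *
        (DistCov.uStat n (fun i => (Xs i ω, Ys i ω)) - (DistCov.dcovSq P X Y).toReal))
      atTop Z (fun _ => P') Q := by
  obtain ⟨hfinite, hdcov⟩ := DistCov.dcovSq_lt_top_and_toReal_eq_integral_kernel hX hY hX1 hY1
  refine ⟨hfinite, ?_⟩
  set μ := P.map fun ω => (X ω, Y ω)
  have hXY : HasLaw (fun ω => (X ω, Y ω)) μ P := ⟨(hX.prodMk hY).aemeasurable, rfl⟩
  have hμ : IsProbabilityMeasure μ := Measure.isProbabilityMeasure_map hXY.aemeasurable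
  have hsample (i : ℕ) : HasLaw (fun ω => (Xs i ω, Ys i ω)) μ P' :=
    ⟨(hident i).aemeasurable_fst, (hident i).map_eq⟩
  have hvariance : Var[DistCov.firstProj μ DistCov.kernel; μ] =
      variance (fun ω => DistCov.kernelProj μ (X ω, Y ω)) P :=
    variance_map (DistCov.memLp_firstProj hker).aestronglyMeasurable.aemeasurable hXY.aemeasurable
  have horder : ((3 : ℕ) + 1 : ℝ) ^ 2 = 16 := by norm_num
  rw [hdcov]
  exact DistCov.tendstoInDistribution_uStatistic hindep hsample DistCov.kernel_comp_perm hker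
    (by rwa [horder, hvariance])
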